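/- Let $\mathcal N$ be a finite-dimensional quantum channel with isometric extension $V:A\to B\otimes E$, $\mathcal N(\rho)=\mathrm{Tr}_E(V\rho V^\dagger)$, and complementary channel $\mathcal N^c(\rho)=\mathrm{Tr}_B(V\rho V^\dagger)$; $\mathcal N$ is degradable if $\mathcal N^c=\mathcal D\circ\mathcal N$ for some quantum channel $\mathcal D$. Let $H$ be a Hermitian operator on $B$, and let $H_n=\sum_{i=1}^n 1\otimes\cdots\otimes H\otimes\cdots\otimes 1$ be the total Hamiltonian of $n$ copies of the output. With $S$ the von Neumann entropy and $\chi(\mathcal M;\{p_x,\rho_x\})=S(\mathcal M(\sum_x p_x\rho_x))-\sum_x p_xS(\mathcal M(\rho_x))$ the Holevo quantity, let $\chi_P^{(n)}(\xi)=\chi(\mathcal N^{\otimes n};\xi)-\chi((\mathcal N^{\otimes n})^{c};\xi)$ be the private information of a finite ensemble $\xi$ of states on $A^{\otimes n}$ with average state $\rho_\xi$. Consider one of the following two settings, in which an ensemble on $A$ is called allowed: (CQ) signal states $\rho_x$, $x\in X$, $X$ finite, are fixed, and the allowed ensembles are $\{p_x,\rho_x\}_{x\in X}$ with an arbitrary probability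 distribution $p$ on $X$; (General) the allowed ensembles are all finite ensembles of states from a given class $\mathcal S$ of states (for example all states, or all pure states). Let $P_1^Q(B)=\sup \chi_P^{(1)}(\xi)$ over the allowed $\xi$ with $\mathrm{Tr}(H\,\mathcal N(\rho_\xi))\ge B$, and let $P_n^Q(B)=\sup\chi_P^{(n)}(\xi)$ over the uncorrelated product ensembles $\xi=\xi_1\otimes\cdots\otimes\xi_n$ of allowed ensembles (which may differ from one use to another) with $\mathrm{Tr}(H_n\,\mathcal N^{\otimes n}(\rho_\xi))\ge nB$. Call $B$ feasible if some allowed $\xi$ satisfies the constraint in the definition of $P_1^Q(B)$. Suppose that either the setting is (CQ) and $\mathcal N$ is degradable, or the setting is (CQ) or (General) and $P_1^Q$ is a concave function of $B$ on the set of feasible $B$. Then, for every $n\ge1$, the constraint in the definition of $P_n^Q(B)$ can be met if and only if $B$ is feasible, and for every feasible $B$ $$P_n^Q(B)=n\,P_1^Q(B)\quad(n\ge1),\qquad \sup_{n\ge1}\tfrac1n P_n^Q(B)=P_1^Q(B).$$ The suprema defining $P_1^Q(B)$ and $P_n^Q(B)$ are finite, and in setting (CQ) they are maxima. Moreover, in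 setting (CQ) with $\mathcal N$ degradable, for every feasible $B$ the regularized private capacity-power function is given by the single-letter formula $$\sup_{n\ge1}\frac1n\ \max_{p}\ \chi_P^{(n)}\big(\{p_{x^n},\rho_{x_1}\otimes\cdots\otimes\rho_{x_n}\}\big)=\max_{p:\ \mathrm{Tr}(H\mathcal N(\sum_x p_x\rho_x))\ge B}\chi_P^{(1)}(\{p_x,\rho_x\})=P_1^Q(B),$$ where on the left $p$ ranges over all (possibly correlated) probability distributions on $X^n$ with total average output energy $\mathrm{Tr}(H_n\,\mathcal N^{\otimes n}(\rho_\xi))\ge nB$, $\rho_\xi=\sum_{x^n}p_{x^n}\rho_{x_1}\otimes\cdots\otimes\rho_{x_n}$. -/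

import Mathlib

open scoped Matrix ComplexOrder

noncomputable section

/-- A density matrix (quantum state): positive semidefinite of trace one. -/
def IsDensityMatrix {a : Type*} [Fintype a] (ρ : Matrix a a ℂ) : Prop :=
  ρ.PosSemidef ∧ ρ.trace = 1

/-- The von Neumann entropy `S(ρ) = -Tr (ρ log ρ)` (natural logarithm, `0 log 0 = 0`). -/
def vonNeumannEntropy {a : Type*} [Fintype a] [DecidableEq a] (ρ : Matrix a a ℂ) : ℝ :=
  (cfc Real.negMulLog ρ).trace.re

/-- A quantum channel from system `a` to system `b` with environment `e`, presented by its
isometric extension `V : a → b ⊗ e`. -/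
structure QChannel (a b e : Type*) [Fintype a] [Fintype b] [Fintype e] [DecidableEq a] where
  V : Matrix (b × e) a ℂ
  isometry : Vᴴ * V = 1

/-- The tensor product `M₁ ⊗ ⋯ ⊗ Mₙ` of matrices. -/
def tensorMatrix {r c : Type*} {n : ℕ} (M : Fin n → Matrix r c ℂ) :
    Matrix (Fin n → r) (Fin n → c) ℂ :=
  Matrix.of fun x y => ∏ i, M i (x i) (y i)

namespace QChannel

variable {a b e : Type*} [Fintype a] [Fintype b] [Fintype e] [DecidableEq a]

/-- The action `N(ρ) = Tr_e (V ρ V†)` of the channel. -/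
def map (N : QChannel a b e) (ρ : Matrix a a ℂ) : Matrix b b ℂ :=
  Matrix.of fun y y' => ∑ z, (N.V * ρ * N.Vᴴ) (y, z) (y', z)

/-- The complementary channel, from the system `a` to the environment `e`:
`Nᶜ(ρ) = Tr_b (V ρ V†)`. -/
def complementary (N : QChannel a b e) : QChannel a e b where
  V := N.V.submatrix Prod.swap id
  isometry := by
    rw [← N.isometry]
    ext x y
    simp only [Matrix.mul_apply, Matrix.conjTranspose_apply, Matrix.submatrix_apply, id]
    exact (Equiv.prodComm e b).sum_comp (fun z => star (N.V z x) * N.V z y)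

/-- The `n`-fold tensor power `N^{⊗ n}`, whose isometric extension is `V^{⊗ n}` with the `n`
outputs and the `n` environments grouped together. -/
def tensorPow (N : QChannel a b e) (n : ℕ) :
    QChannel (Fin n → a) (Fin n → b) (Fin n → e) where
  V := (tensorMatrix fun _ : Fin n => N.V).submatrix
    (fun w : (Fin n → b) × (Fin n → e) => fun i => (w.1 i, w.2 i)) id
  isometry := by
    ext x y
    have h : ∀ i, ∑ w : b × e, star (N.V w (x i)) * N.V w (y i)
        = (1 : Matrix a a ℂ) (x i) (y i) := by
      intro i
      rw [← N.isometry]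
      simp [Matrix.mul_apply, Matrix.conjTranspose_apply]
    have h2 : (∏ i, (1 : Matrix a a ℂ) (x i) (y i))
        = (1 : Matrix (Fin n → a) (Fin n → a) ℂ) x y := by
      by_cases hxy : x = y
      · subst hxy; simp
      · rw [Matrix.one_apply_ne hxy]
        obtain ⟨i, hi⟩ := Function.ne_iff.mp hxy
        exact Finset.prod_eq_zero (Finset.mem_univ i) (Matrix.one_apply_ne hi)
    rw [← h2, ← Finset.prod_congr rfl (fun i _ => h i)]
    have h3 := Finset.prod_univ_sum (fun _ : Fin n => (Finset.univ : Finset (b × e)))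
      (fun i w => star (N.V w (x i)) * N.V w (y i))
    rw [h3, Fintype.piFinset_univ]
    simp only [Matrix.mul_apply, Matrix.conjTranspose_apply, Matrix.submatrix_apply, id,
      tensorMatrix, Matrix.of_apply]
    rw [← (Equiv.arrowProdEquivProdArrow (Fin n) (fun _ => b) (fun _ => e)).sum_comp]
    refine Finset.sum_congr rfl fun w _ => ?_
    simp [Equiv.arrowProdEquivProdArrow, Finset.prod_mul_distrib]

/-- `N` is degradable if its complementary channel factors through it, `Nᶜ = D ∘ N`, for some
quantum channel `D` from `b` to `e`. -/
def Degradable [DecidableEq b] (N : QChannel a b e) : Prop :=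
  ∃ (r : ℕ) (D : QChannel b e (Fin r)), ∀ ρ, N.complementary.map ρ = D.map (N.map ρ)

variable {X : Type*} [Fintype X]

/-- The average state `∑ₓ pₓ ρₓ` of an ensemble. -/
def _root_.averageState (p : X → ℝ) (ρ : X → Matrix a a ℂ) : Matrix a a ℂ :=
  ∑ x, (p x : ℂ) • ρ x

/-- The Holevo quantity `S(N(∑ₓ pₓ ρₓ)) - ∑ₓ pₓ S(N(ρₓ))` of the output ensemble. -/
def holevo [DecidableEq b] (N : QChannel a b e) (p : X → ℝ) (ρ : X → Matrix a a ℂ) : ℝ :=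
  vonNeumannEntropy (N.map (averageState p ρ)) - ∑ x, p x * vonNeumannEntropy (N.map (ρ x))

/-- The private information `χ_AB - χ_AE` of an input ensemble. -/
def privateInfo [DecidableEq b] [DecidableEq e] (N : QChannel a b e)
    (p : X → ℝ) (ρ : X → Matrix a a ℂ) : ℝ :=
  N.holevo p ρ - N.complementary.holevo p ρ

/-- The average output energy `Tr (H N(∑ₓ pₓ ρₓ))`. -/
def outputEnergy (N : QChannel a b e) (H : Matrix b b ℂ)
    (p : X → ℝ) (ρ : X → Matrix a a ℂ) : ℝ :=
  (H * N.map (averageState p ρ)).trace.re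

end QChannel

/-- The Hamiltonian of `n` non-interacting copies of a system with Hamiltonian `H`:
`∑ᵢ 1 ⊗ ⋯ ⊗ H ⊗ ⋯ ⊗ 1`, with `H` in position `i`. -/
def totalHamiltonian {b : Type*} [DecidableEq b] (n : ℕ) (H : Matrix b b ℂ) :
    Matrix (Fin n → b) (Fin n → b) ℂ :=
  ∑ i, tensorMatrix (Function.update (fun _ => (1 : Matrix b b ℂ)) i H)

/-- The probabilities `p₁(x₁) ⋯ pₙ(xₙ)` of a product ensemble. -/
def prodProb {n : ℕ} {X : Fin n → Type*} (p : ∀ i, X i → ℝ) (x : ∀ i, X i) : ℝ :=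
  ∏ i, p i (x i)

/-- The signal states `ρ₁(x₁) ⊗ ⋯ ⊗ ρₙ(xₙ)` of a product ensemble. -/
def prodState {a : Type*} {n : ℕ} {X : Fin n → Type*} (ρ : ∀ i, X i → Matrix a a ℂ)
    (x : ∀ i, X i) : Matrix (Fin n → a) (Fin n → a) ℂ :=
  tensorMatrix fun i => ρ i (x i)

section CapacityPower

variable {a b e : Type*} [Fintype a] [Fintype b] [Fintype e]
  [DecidableEq a] [DecidableEq b] [DecidableEq e]

/-! Classical-quantum setting: the signal states `ρₓ` are fixed, only probabilities vary. -/

variable {X : Type*} [Fintype X]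

/-- Single use: the values `χ_AB - χ_AE` over all probability distributions whose average output
energy is at least `B`. -/
def cqRatesOne (N : QChannel a b e) (H : Matrix b b ℂ) (ρ : X → Matrix a a ℂ) (B : ℝ) : Set ℝ :=
  {r | ∃ p ∈ stdSimplex ℝ X, B ≤ N.outputEnergy H p ρ ∧ r = N.privateInfo p ρ}

/-- `n` uses with uncorrelated inputs: product distributions `p₁ × ⋯ × pₙ` on the product signal
states, with total average output energy at least `n B`. -/
def cqRates (N : QChannel a b e) (H : Matrix b b ℂ) (ρ : X → Matrix a a ℂ) (n : ℕ) (B : ℝ) :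
    Set ℝ :=
  {r | ∃ p : Fin n → X → ℝ, (∀ i, p i ∈ stdSimplex ℝ X) ∧
    n * B ≤ (N.tensorPow n).outputEnergy (totalHamiltonian n H)
      (prodProb p) (prodState fun _ => ρ) ∧
    r = (N.tensorPow n).privateInfo (prodProb p) (prodState fun _ => ρ)}

/-- `n` uses with arbitrary (possibly correlated) distributions on the product signal states. -/
def cqRatesCorrelated (N : QChannel a b e) (H : Matrix b b ℂ) (ρ : X → Matrix a a ℂ)
    (n : ℕ) (B : ℝ) : Set ℝ :=
  {r | ∃ p ∈ stdSimplex ℝ (Fin n → X),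
    n * B ≤ (N.tensorPow n).outputEnergy (totalHamiltonian n H) p (prodState fun _ => ρ) ∧
    r = (N.tensorPow n).privateInfo p (prodState fun _ => ρ)}

/-- `P₁(B)` for fixed signal states. -/
def cqPrivateOne (N : QChannel a b e) (H : Matrix b b ℂ) (ρ : X → Matrix a a ℂ) (B : ℝ) : ℝ :=
  sSup (cqRatesOne N H ρ B)

/-- `Pₙ(B)` for fixed signal states and uncorrelated inputs. -/
def cqPrivate (N : QChannel a b e) (H : Matrix b b ℂ) (ρ : X → Matrix a a ℂ)
    (n : ℕ) (B : ℝ) : ℝ :=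
  sSup (cqRates N H ρ n B)

/-- `Pₙ(B)` for fixed signal states and arbitrarily distributed inputs. -/
def cqPrivateCorrelated (N : QChannel a b e) (H : Matrix b b ℂ) (ρ : X → Matrix a a ℂ)
    (n : ℕ) (B : ℝ) : ℝ :=
  sSup (cqRatesCorrelated N H ρ n B)

/-! General setting: probabilities and signal states both vary, the states within a prescribed
class `𝒮` (all states, all pure states, ...). -/

/-- Single use: the values `χ_AB - χ_AE` over all finite ensembles of states in `𝒮` whose average
output energy is at least `B`. -/
def ratesOne (N : QChannel a b e) (H : Matrix b b ℂ) (𝒮 : Set (Matrix a a ℂ)) (B : ℝ) : Set ℝ :=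
  {r | ∃ (m : ℕ) (p : Fin m → ℝ) (σ : Fin m → Matrix a a ℂ),
    p ∈ stdSimplex ℝ (Fin m) ∧ (∀ x, σ x ∈ 𝒮) ∧
    B ≤ N.outputEnergy H p σ ∧ r = N.privateInfo p σ}

/-- `n` uses with uncorrelated inputs: tensor products of `n` finite ensembles of states in `𝒮`
with total average output energy at least `n B`. -/
def rates (N : QChannel a b e) (H : Matrix b b ℂ) (𝒮 : Set (Matrix a a ℂ)) (n : ℕ) (B : ℝ) :
    Set ℝ :=
  {r | ∃ (m : Fin n → ℕ) (p : ∀ i, Fin (m i) → ℝ) (σ : ∀ i, Fin (m i) → Matrix a a ℂ),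
    (∀ i, p i ∈ stdSimplex ℝ (Fin (m i))) ∧ (∀ i x, σ i x ∈ 𝒮) ∧
    n * B ≤ (N.tensorPow n).outputEnergy (totalHamiltonian n H) (prodProb p) (prodState σ) ∧
    r = (N.tensorPow n).privateInfo (prodProb p) (prodState σ)}

/-- `P₁(B)` with signal states in `𝒮`. -/
def privateOne (N : QChannel a b e) (H : Matrix b b ℂ) (𝒮 : Set (Matrix a a ℂ)) (B : ℝ) : ℝ :=
  sSup (ratesOne N H 𝒮 B)

/-- `Pₙ(B)` with signal states in `𝒮` and uncorrelated inputs. -/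
def privateN (N : QChannel a b e) (H : Matrix b b ℂ) (𝒮 : Set (Matrix a a ℂ))
    (n : ℕ) (B : ℝ) : ℝ :=
  sSup (rates N H 𝒮 n B)

end CapacityPower

end

/-! The theorem combines additivity of the private information over product ensembles with Jensen's
inequality in the energy. For a product ensemble both Holevo quantities and the energy are sums over
the uses, so an n-use value is ∑ rᵢ with rᵢ attainable in one use at energy Eᵢ and ∑ Eᵢ ≥ nB.
Concavity of the one-use optimum, together with its monotonicity in the energy demand, bounds this
by n P₁(B) (`sum_le_mul_sSup`); repeating one ensemble n times gives the reverse bound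
(`isLUB_mul_sSup`).

Degradability enters through the entropy difference S(B) − S(E). The private information is this
difference at the average state minus its mean over the signals; the mean is linear in the
distribution and additive on product signals. When Nᶜ = D ∘ N, the difference is the entropy lost
under D. Monotonicity of relative entropy, applied to a separable output state against the product
of its marginals, makes this loss subadditive (`entropy_sub_tensorPow_le`), so correlated inputs do
not beat their marginals. Applied to Holevo quantities, it makes the loss concave
(`holevo_postprocess_le`), hence P₁ concave.

Monotonicity of relative entropy is proved here without operator logarithms. In eigenbases of ρ and
σ with eigenvalues pᵢ and qⱼ, the function ∑ |⟨j|i⟩|² pᵢ log(qⱼ + t pᵢ) yields the two terms of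
D(ρ‖σ) as t → ∞ and t → 0. Its derivative ∑ |⟨j|i⟩|² pᵢ² / (qⱼ + t pᵢ) is the maximum of a quadratic
functional of a matrix Z. Pulling Z back through the channel shows that this maximum cannot increase
under the channel; comparing the limits finishes the argument. -/

noncomputable section

/-! ### Spectral description of the entropy -/

section Diagonalization

variable {d : Type*} [Fintype d] [DecidableEq d]

/-- `W` is unitary and `σ = W diag(q) W†`. -/
structure Diagonalizes (W : Matrix d d ℂ) (q : d → ℝ) (σ : Matrix d d ℂ) : Prop where
  unitary : Wᴴ * W = 1
  eq : σ = W * Matrix.diagonal (fun j => (q j : ℂ)) * Wᴴ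

theorem Diagonalizes.unitary' {W : Matrix d d ℂ} {q : d → ℝ} {σ : Matrix d d ℂ}
    (h : Diagonalizes W q σ) : W * Wᴴ = 1 :=
  mul_eq_one_comm.mp h.unitary

theorem Diagonalizes.conj_eq {W : Matrix d d ℂ} {q : d → ℝ} {σ : Matrix d d ℂ}
    (h : Diagonalizes W q σ) : Wᴴ * σ * W = Matrix.diagonal (fun j => (q j : ℂ)) := by
  have h1 := h.unitary
  calc Wᴴ * σ * W = (Wᴴ * W) * Matrix.diagonal (fun j => (q j : ℂ)) * (Wᴴ * W) := by
        rw [h.eq]; simp only [Matrix.mul_assoc]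
    _ = _ := by rw [h1]; simp

theorem Diagonalizes.nonneg {W : Matrix d d ℂ} {q : d → ℝ} {σ : Matrix d d ℂ}
    (h : Diagonalizes W q σ) (hσ : σ.PosSemidef) (j : d) : 0 ≤ q j := by
  have h1 := (hσ.conjTranspose_mul_mul_same W).diag_nonneg (i := j)
  rw [h.conj_eq, Matrix.diagonal_apply_eq] at h1
  exact_mod_cast h1

theorem Diagonalizes.trace_eq {W : Matrix d d ℂ} {q : d → ℝ} {σ : Matrix d d ℂ}
    (h : Diagonalizes W q σ) : σ.trace = ((∑ j, q j : ℝ) : ℂ) := by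
  rw [h.eq, Matrix.trace_mul_comm, ← Matrix.mul_assoc, h.unitary, Matrix.one_mul,
    Matrix.trace_diagonal, Complex.ofReal_sum]

theorem Diagonalizes.sum_eq_one {W : Matrix d d ℂ} {q : d → ℝ} {σ : Matrix d d ℂ}
    (h : Diagonalizes W q σ) (hσ : IsDensityMatrix σ) : ∑ j, q j = 1 := by
  have h1 := h.trace_eq
  rw [hσ.2] at h1
  exact_mod_cast h1.symm

theorem Matrix.IsHermitian.diagonalizes {σ : Matrix d d ℂ} (h : σ.IsHermitian) :
    Diagonalizes (h.eigenvectorUnitary : Matrix d d ℂ) h.eigenvalues σ where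
  unitary := by
    rw [← Matrix.star_eq_conjTranspose]
    exact Unitary.coe_star_mul_self h.eigenvectorUnitary
  eq := by
    conv_lhs => rw [h.spectral_theorem, Unitary.conjStarAlgAut_apply]
    rfl

open Polynomial in
/-- The von Neumann entropy is the Shannon entropy of the spectrum. -/
theorem Diagonalizes.entropy_eq {W : Matrix d d ℂ} {q : d → ℝ} {σ : Matrix d d ℂ}
    (h : Diagonalizes W q σ) : vonNeumannEntropy σ = ∑ j, Real.negMulLog (q j) := by
  have hH : σ.IsHermitian := by
    rw [h.eq]
    refine Matrix.isHermitian_mul_mul_conjTranspose _ ?_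
    rw [Matrix.isHermitian_diagonal_iff]
    intro j
    exact Complex.conj_ofReal _
  -- The characteristic polynomial determines the spectrum with multiplicity, so any diagonalization
  -- may replace the canonical one; product eigenbases rely on this.
  have hroots : Multiset.map (fun j => (q j : ℂ)) Finset.univ.val
      = Multiset.map (fun j => (hH.eigenvalues j : ℂ)) Finset.univ.val := by
    have h1 := hH.roots_charpoly_eq_eigenvalues
    have h2 : σ.charpoly = ∏ j, (X - C (q j : ℂ)) := by
      conv_lhs => rw [h.eq, Matrix.charpoly_mul_comm, ← Matrix.mul_assoc, h.unitary,
        Matrix.one_mul, Matrix.charpoly_diagonal]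
    rw [h2,
      Polynomial.roots_prod _ _ (Finset.prod_ne_zero_iff.mpr fun i _ => X_sub_C_ne_zero _)] at h1
    simpa using h1
  have hroots' : Multiset.map q Finset.univ.val
      = Multiset.map hH.eigenvalues Finset.univ.val := by
    have := congrArg (Multiset.map Complex.re) hroots
    simpa [Multiset.map_map, Function.comp_def] using this
  have h3 : (cfc Real.negMulLog σ).trace = ((∑ j, Real.negMulLog (hH.eigenvalues j) : ℝ) : ℂ) := by
    rw [hH.cfc_eq, Matrix.IsHermitian.cfc, Unitary.conjStarAlgAut_apply, Matrix.trace_mul_comm,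
      ← Matrix.mul_assoc, Unitary.coe_star_mul_self, Matrix.one_mul, Matrix.trace_diagonal]
    simp
  rw [vonNeumannEntropy, h3, Complex.ofReal_re]
  have := congrArg (fun s : Multiset ℝ => (s.map Real.negMulLog).sum) hroots'
  simpa [Multiset.map_map, Function.comp_def] using this.symm

theorem IsDensityMatrix.entropy_nonneg {σ : Matrix d d ℂ} (h : IsDensityMatrix σ) :
    0 ≤ vonNeumannEntropy σ := by
  have hd := h.1.1.diagonalizes
  rw [hd.entropy_eq]
  refine Finset.sum_nonneg fun j _ => Real.negMulLog_nonneg (hd.nonneg h.1 j) ?_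
  rw [← hd.sum_eq_one h]
  exact Finset.single_le_sum (fun i _ => hd.nonneg h.1 i) (Finset.mem_univ j)

theorem IsDensityMatrix.entropy_le {σ : Matrix d d ℂ} (h : IsDensityMatrix σ) :
    vonNeumannEntropy σ ≤ Fintype.card d := by
  have hd := h.1.1.diagonalizes
  rw [hd.entropy_eq]
  calc ∑ j, Real.negMulLog (h.1.1.eigenvalues j) ≤ ∑ _j : d, (1 : ℝ) := by
        -- From `1 - 1/x ≤ log x` one gets `-x log x ≤ 1 - x ≤ 1`. The bound is crude, but only
        -- finiteness of the suprema is at stake.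
        refine Finset.sum_le_sum fun j _ => ?_
        have h0 := hd.nonneg h.1 j
        rcases h0.eq_or_lt with h0 | h0
        · simp [← h0]
        · have h2 := mul_le_mul_of_nonneg_left (Real.one_sub_inv_le_log_of_pos h0) h0.le
          rw [mul_sub, mul_inv_cancel₀ h0.ne'] at h2
          rw [Real.negMulLog]
          linarith
    _ = Fintype.card d := by simp

end Diagonalization

/-! ### Tensor products of matrices and states -/

section Tensor

variable {n : ℕ} {r s t : Type*}

theorem tensorMatrix_mul [Fintype s] (A : Fin n → Matrix r s ℂ) (B : Fin n → Matrix s t ℂ) :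
    tensorMatrix A * tensorMatrix B = tensorMatrix fun i => A i * B i := by
  ext x y
  simp only [tensorMatrix, Matrix.mul_apply, Matrix.of_apply, ← Finset.prod_mul_distrib]
  rw [Finset.prod_univ_sum, Fintype.piFinset_univ]

theorem tensorMatrix_conjTranspose (A : Fin n → Matrix r s ℂ) :
    (tensorMatrix A)ᴴ = tensorMatrix fun i => (A i)ᴴ := by
  ext x y
  simp [tensorMatrix]

theorem tensorMatrix_diagonal [DecidableEq r] (q : Fin n → r → ℂ) :
    tensorMatrix (fun i => Matrix.diagonal (q i)) = Matrix.diagonal fun x => ∏ i, q i (x i) := by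
  ext x y
  by_cases hxy : x = y
  · subst hxy; simp [tensorMatrix]
  · rw [Matrix.diagonal_apply_ne _ hxy]
    obtain ⟨i, hi⟩ := Function.ne_iff.mp hxy
    exact Finset.prod_eq_zero (Finset.mem_univ i) (Matrix.diagonal_apply_ne _ hi)

theorem tensorMatrix_one [DecidableEq r] :
    tensorMatrix (fun _ : Fin n => (1 : Matrix r r ℂ)) = 1 := by
  simp only [← Matrix.diagonal_one, tensorMatrix_diagonal, Finset.prod_const_one]

theorem tensorMatrix_trace [Fintype r] (A : Fin n → Matrix r r ℂ) :
    (tensorMatrix A).trace = ∏ i, (A i).trace := by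
  simp only [tensorMatrix, Matrix.trace, Matrix.diag, Matrix.of_apply]
  rw [Finset.prod_univ_sum, Fintype.piFinset_univ]

theorem Diagonalizes.tensor [Fintype r] [DecidableEq r] {W : Fin n → Matrix r r ℂ}
    {q : Fin n → r → ℝ} {σ : Fin n → Matrix r r ℂ} (h : ∀ i, Diagonalizes (W i) (q i) (σ i)) :
    Diagonalizes (tensorMatrix W) (fun x => ∏ i, q i (x i)) (tensorMatrix σ) where
  unitary := by
    rw [tensorMatrix_conjTranspose, tensorMatrix_mul]
    simp only [(h _).unitary, tensorMatrix_one]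
  eq := by
    have h1 := tensorMatrix_diagonal fun i j => (q i j : ℂ)
    push_cast
    rw [← h1, tensorMatrix_conjTranspose, tensorMatrix_mul, tensorMatrix_mul]
    exact congrArg tensorMatrix (funext fun i => (h i).eq)

theorem Matrix.PosSemidef.tensor [Fintype r] {σ : Fin n → Matrix r r ℂ}
    (h : ∀ i, (σ i).PosSemidef) : (tensorMatrix σ).PosSemidef := by
  classical
  have h1 := fun i => (h i).1.diagonalizes
  rw [(Diagonalizes.tensor h1).eq]
  refine Matrix.PosSemidef.mul_mul_conjTranspose_same (Matrix.PosSemidef.diagonal fun x => ?_) _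
  have h2 : 0 ≤ ∏ i, (h i).1.eigenvalues (x i) :=
    Finset.prod_nonneg fun i _ => (h1 i).nonneg (h i) _
  exact Complex.zero_le_real.mpr h2

theorem IsDensityMatrix.tensor [Fintype r] {σ : Fin n → Matrix r r ℂ}
    (h : ∀ i, IsDensityMatrix (σ i)) : IsDensityMatrix (tensorMatrix σ) :=
  ⟨Matrix.PosSemidef.tensor fun i => (h i).1, by simp [tensorMatrix_trace, (h _).2]⟩

end Tensor

/-! ### Average states -/

section Average

variable {X a : Type*} [Fintype X] [Fintype a]

theorem IsDensityMatrix.average {p : X → ℝ} {ρ : X → Matrix a a ℂ} (hp : p ∈ stdSimplex ℝ X)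
    (hρ : ∀ x, IsDensityMatrix (ρ x)) : IsDensityMatrix (averageState p ρ) := by
  constructor
  · refine Matrix.posSemidef_sum _ fun x _ => (hρ x).1.smul ?_
    exact_mod_cast hp.1 x
  · simp only [averageState, Matrix.trace_sum, Matrix.trace_smul, (hρ _).2, smul_eq_mul, mul_one]
    exact_mod_cast hp.2

end Average

/-! ### Channels in Kraus form and their tensor powers -/

namespace QChannel

variable {a b e : Type*} [Fintype a] [Fintype b] [Fintype e] [DecidableEq a]

/-- The Kraus operators of the channel. -/
def kraus (N : QChannel a b e) (z : e) : Matrix b a ℂ := Matrix.of fun y x => N.V (y, z) x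

theorem map_eq_sum_kraus (N : QChannel a b e) (ρ : Matrix a a ℂ) :
    N.map ρ = ∑ z, N.kraus z * ρ * (N.kraus z)ᴴ := by
  ext y y'
  simp [map, kraus, Matrix.sum_apply, Matrix.mul_apply]

theorem map_averageState {X : Type*} [Fintype X] (N : QChannel a b e) (p : X → ℝ)
    (ρ : X → Matrix a a ℂ) :
    N.map (averageState p ρ) = averageState p fun x => N.map (ρ x) := by
  simp only [map_eq_sum_kraus, averageState, Matrix.mul_sum, Matrix.sum_mul, Finset.smul_sum,
    Matrix.mul_smul, Matrix.smul_mul]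
  exact Finset.sum_comm

-- The adjoint of the partial trace is Z ↦ Z ⊗ 1; this moves test operators from the output to the
-- dilation.
open scoped Kronecker in
theorem trace_mul_map [DecidableEq e] (N : QChannel a b e) (Z : Matrix b b ℂ) (ρ : Matrix a a ℂ) :
    (Z * N.map ρ).trace = (Z ⊗ₖ (1 : Matrix e e ℂ) * (N.V * ρ * N.Vᴴ)).trace := by
  simp only [map, Matrix.trace, Matrix.diag, Matrix.mul_apply (M := Z),
    Matrix.mul_apply (M := Z ⊗ₖ (1 : Matrix e e ℂ)), Fintype.sum_prod_type, Matrix.of_apply,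
    Matrix.kroneckerMap_apply, Matrix.one_apply, mul_ite, mul_one, mul_zero, ite_mul, zero_mul,
    Finset.sum_ite_eq, Finset.mem_univ, if_true, Finset.mul_sum]
  exact Finset.sum_congr rfl fun _ _ => Finset.sum_comm

theorem trace_map (N : QChannel a b e) (ρ : Matrix a a ℂ) : (N.map ρ).trace = ρ.trace := by
  classical
  have h := N.trace_mul_map 1 ρ
  rw [Matrix.one_mul, Matrix.one_kronecker_one, Matrix.one_mul] at h
  rw [h, Matrix.trace_mul_comm, ← Matrix.mul_assoc, N.isometry, Matrix.one_mul]

theorem posSemidef_map (N : QChannel a b e) {ρ : Matrix a a ℂ} (hρ : ρ.PosSemidef) :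
    (N.map ρ).PosSemidef := by
  rw [map_eq_sum_kraus]
  exact Matrix.posSemidef_sum _ fun z _ => hρ.mul_mul_conjTranspose_same _

theorem isDensityMatrix_map (N : QChannel a b e) {ρ : Matrix a a ℂ} (hρ : IsDensityMatrix ρ) :
    IsDensityMatrix (N.map ρ) :=
  ⟨N.posSemidef_map hρ.1, by rw [trace_map, hρ.2]⟩

/-- Outputs and environments are grouped separately in the tensor power, so facts about powers of a
channel transfer verbatim to its complement. -/
theorem complementary_tensorPow (N : QChannel a b e) (n : ℕ) :
    (N.tensorPow n).complementary = N.complementary.tensorPow n := rfl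

theorem tensorPow_map_tensorMatrix (N : QChannel a b e) {n : ℕ} (ρ : Fin n → Matrix a a ℂ) :
    (N.tensorPow n).map (tensorMatrix ρ) = tensorMatrix fun i => N.map (ρ i) := by
  have hk : ∀ z : Fin n → e, (N.tensorPow n).kraus z = tensorMatrix fun i => N.kraus (z i) := by
    intro z
    rfl
  rw [map_eq_sum_kraus]
  simp only [hk, tensorMatrix_conjTranspose, tensorMatrix_mul]
  ext x y
  simp only [Matrix.sum_apply, tensorMatrix, Matrix.of_apply, map_eq_sum_kraus]
  rw [Finset.prod_univ_sum, Fintype.piFinset_univ]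

end QChannel

/-! ### Scalar interpolation behind relative entropy -/

section RealInterpolation

open Filter Topology

variable {κ : Type*} [Fintype κ]

/-- Interpolates between the two terms of a relative entropy: up to a multiple of `log t` it tends
to `∑ w p log p` as `t → ∞`, and to `∑ w p log q` as `t → 0`. -/
def logInterpolation (w p q : κ → ℝ) (t : ℝ) : ℝ :=
  ∑ k, w k * p k * Real.log (q k + t * p k)

variable {w p q : κ → ℝ}

theorem hasDerivAt_logInterpolation (hp : ∀ k, 0 ≤ p k) (hq : ∀ k, 0 ≤ q k) {t : ℝ} (ht : 0 < t) :
    HasDerivAt (logInterpolation w p q) (∑ k, w k * (p k ^ 2 / (q k + t * p k))) t := by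
  unfold logInterpolation
  refine HasDerivAt.fun_sum fun k _ => ?_
  rcases (hp k).eq_or_lt with h0 | h0
  · simp only [← h0]
    simpa using hasDerivAt_const t (0 : ℝ)
  · have h1 : 0 < q k + t * p k := by have := hq k; positivity
    have h2 : HasDerivAt (fun t : ℝ => q k + t * p k) (p k) t := by
      simpa using ((hasDerivAt_id t).mul_const (p k)).const_add (q k)
    have h3 := (h2.log h1.ne').const_mul (w k * p k)
    refine h3.congr_deriv ?_
    field_simp

theorem tendsto_logInterpolation_zero (h : ∀ k, q k = 0 → w k * p k = 0) :
    Tendsto (logInterpolation w p q) (𝓝[>] 0) (𝓝 (∑ k, w k * p k * Real.log (q k))) := by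
  unfold logInterpolation
  refine tendsto_finsetSum _ fun k _ => ?_
  by_cases h0 : q k = 0
  · simp [h k h0]
  · have h1 : ContinuousAt (fun t : ℝ => w k * p k * Real.log (q k + t * p k)) 0 := by
      refine continuousAt_const.mul (ContinuousAt.log (by fun_prop) (by simpa using h0))
    have h2 := h1.tendsto.mono_left (nhdsWithin_le_nhds (s := Set.Ioi 0))
    simpa using h2

/-- Where p is positive, log(q + tp) = log t + log(q/t + p); terms with p = 0 contribute nothing. -/
theorem tendsto_logInterpolation_atTop (hp : ∀ k, 0 ≤ p k) (hq : ∀ k, 0 ≤ q k) :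
    Tendsto (fun t => logInterpolation w p q t - (∑ k, w k * p k) * Real.log t) atTop
      (𝓝 (∑ k, w k * p k * Real.log (p k))) := by
  have h1 : Tendsto (fun t : ℝ => ∑ k, w k * p k * Real.log (q k * t⁻¹ + p k)) atTop
      (𝓝 (∑ k, w k * p k * Real.log (p k))) := by
    refine tendsto_finsetSum _ fun k _ => ?_
    by_cases h0 : p k = 0
    · simp [h0]
    · refine (Tendsto.log ?_ h0).const_mul _
      simpa using (tendsto_inv_atTop_zero.const_mul (q k)).add_const (p k)
  refine h1.congr' ?_
  filter_upwards [eventually_gt_atTop 0] with t ht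
  rw [logInterpolation, Finset.sum_mul, ← Finset.sum_sub_distrib]
  refine Finset.sum_congr rfl fun k _ => ?_
  rcases (hp k).eq_or_lt with h0 | h0
  · simp [← h0]
  · have h2 : 0 < q k + t * p k := by have := hq k; positivity
    have h3 : q k * t⁻¹ + p k = (q k + t * p k) / t := by field_simp
    rw [h3, Real.log_div h2.ne' ht.ne']
    ring

/-- The difference of the two interpolations is nondecreasing in t, so its limit at 0 is at most its
limit at infinity. Comparing derivatives thus compares relative entropies with no integral
representation. -/
theorem sum_mul_log_sub_le {κ' : Type*} [Fintype κ'] {w' p' q' : κ' → ℝ}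
    (hp : ∀ k, 0 ≤ p k) (hq : ∀ k, 0 ≤ q k) (hp' : ∀ k, 0 ≤ p' k) (hq' : ∀ k, 0 ≤ q' k)
    (h0 : ∀ k, q k = 0 → w k * p k = 0) (h0' : ∀ k, q' k = 0 → w' k * p' k = 0)
    (hsum : ∑ k, w k * p k = ∑ k, w' k * p' k)
    (hle : ∀ t, 0 < t → ∑ k, w' k * (p' k ^ 2 / (q' k + t * p' k))
      ≤ ∑ k, w k * (p k ^ 2 / (q k + t * p k))) :
    ∑ k, w' k * p' k * Real.log (p' k) - ∑ k, w' k * p' k * Real.log (q' k)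
      ≤ ∑ k, w k * p k * Real.log (p k) - ∑ k, w k * p k * Real.log (q k) := by
  set f : ℝ → ℝ := fun t => logInterpolation w p q t - logInterpolation w' p' q' t with hf
  have hd : ∀ t, 0 < t → HasDerivAt f (∑ k, w k * (p k ^ 2 / (q k + t * p k))
      - ∑ k, w' k * (p' k ^ 2 / (q' k + t * p' k))) t := fun t ht =>
    (hasDerivAt_logInterpolation hp hq ht).sub (hasDerivAt_logInterpolation hp' hq' ht)
  have hmono : MonotoneOn f (Set.Ioi 0) := by
    refine monotoneOn_of_deriv_nonneg (convex_Ioi 0)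
      (fun t ht => (hd t ht).continuousAt.continuousWithinAt)
      (fun t ht => ?_) fun t ht => ?_
    · rw [interior_Ioi] at ht
      exact (hd t ht).differentiableAt.differentiableWithinAt
    · rw [interior_Ioi] at ht
      rw [(hd t ht).deriv]
      exact sub_nonneg.mpr (hle t ht)
  -- The divergent multiples of log t cancel because the total masses agree.
  have htop : Tendsto f atTop (𝓝 (∑ k, w k * p k * Real.log (p k)
      - ∑ k, w' k * p' k * Real.log (p' k))) := by
    refine ((tendsto_logInterpolation_atTop hp hq).sub
      (tendsto_logInterpolation_atTop hp' hq')).congr fun t => ?_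
    rw [hsum, hf]
    ring
  have hbot : Tendsto f (𝓝[>] 0) (𝓝 (∑ k, w k * p k * Real.log (q k)
      - ∑ k, w' k * p' k * Real.log (q' k))) :=
    (tendsto_logInterpolation_zero h0).sub (tendsto_logInterpolation_zero h0')
  have h1 : ∀ s, 0 < s → f s ≤ ∑ k, w k * p k * Real.log (p k)
      - ∑ k, w' k * p' k * Real.log (p' k) := by
    intro s hs
    refine ge_of_tendsto htop ?_
    filter_upwards [eventually_ge_atTop s] with t ht
    exact hmono hs (hs.trans_le ht) ht
  have h2 := le_of_tendsto hbot (eventually_nhdsWithin_of_forall h1)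
  linarith

end RealInterpolation

/-! ### Variational formula for the derivative -/

section Variational

variable {d : Type*} [Fintype d] [DecidableEq d]

/-- The concave quadratic functional whose supremum over `Z` is
`∑ |⟨j|i⟩|² pᵢ² / (qⱼ + t pᵢ)` in eigenbases of `ρ` and `σ`. -/
def overlapFunctional (t : ℝ) (ρ σ Z : Matrix d d ℂ) : ℝ :=
  2 * (Zᴴ * ρ).trace.re - (Zᴴ * σ * Z).trace.re - t * (Z * ρ * Zᴴ).trace.re

variable {U W ρ σ : Matrix d d ℂ} {p q : d → ℝ}

/-- In the two eigenbases the functional decouples into one scalar quadratic per matrix entry, so it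
can be maximized entrywise. -/
theorem overlapFunctional_eq (hρ : Diagonalizes U p ρ) (hσ : Diagonalizes W q σ) (t : ℝ)
    (K : Matrix d d ℂ) :
    overlapFunctional t ρ σ (W * K * Uᴴ) = ∑ k : d × d,
      (2 * (star (K k.1 k.2) * (Wᴴ * U) k.1 k.2).re * p k.2
        - Complex.normSq (K k.1 k.2) * (q k.1 + t * p k.2)) := by
  set P := Matrix.diagonal fun i => (p i : ℂ)
  set Q := Matrix.diagonal fun j => (q j : ℂ)
  have e1 : ((W * K * Uᴴ)ᴴ * ρ).trace = (Kᴴ * (Wᴴ * U) * P).trace := by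
    rw [hρ.eq, Matrix.conjTranspose_mul, Matrix.conjTranspose_mul,
      Matrix.conjTranspose_conjTranspose]
    calc (U * (Kᴴ * Wᴴ) * (U * P * Uᴴ)).trace = (U * (Kᴴ * (Wᴴ * U) * P * Uᴴ)).trace := by
          simp only [Matrix.mul_assoc]
      _ = _ := by
        rw [Matrix.trace_mul_comm, Matrix.mul_assoc _ Uᴴ, hρ.unitary, Matrix.mul_one]
  have e2 : ((W * K * Uᴴ)ᴴ * σ * (W * K * Uᴴ)).trace = (Kᴴ * Q * K).trace := by
    rw [hσ.eq, Matrix.conjTranspose_mul, Matrix.conjTranspose_mul,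
      Matrix.conjTranspose_conjTranspose]
    calc (U * (Kᴴ * Wᴴ) * (W * Q * Wᴴ) * (W * K * Uᴴ)).trace
        = (U * (Kᴴ * (Wᴴ * W) * Q * (Wᴴ * W) * K * Uᴴ)).trace := by
          simp only [Matrix.mul_assoc]
      _ = _ := by
        rw [Matrix.trace_mul_comm, Matrix.mul_assoc _ Uᴴ, hρ.unitary, hσ.unitary]
        simp only [Matrix.mul_one]
  have e3 : (W * K * Uᴴ * ρ * (W * K * Uᴴ)ᴴ).trace = (K * P * Kᴴ).trace := by
    rw [hρ.eq, Matrix.conjTranspose_mul, Matrix.conjTranspose_mul,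
      Matrix.conjTranspose_conjTranspose]
    calc (W * K * Uᴴ * (U * P * Uᴴ) * (U * (Kᴴ * Wᴴ))).trace
        = (W * (K * (Uᴴ * U) * P * (Uᴴ * U) * Kᴴ * Wᴴ)).trace := by
          simp only [Matrix.mul_assoc]
      _ = _ := by
        rw [Matrix.trace_mul_comm, Matrix.mul_assoc _ Wᴴ, hρ.unitary, hσ.unitary]
        simp only [Matrix.mul_one]
  have f1 : (Kᴴ * (Wᴴ * U) * P).trace.re
      = ∑ k : d × d, (star (K k.1 k.2) * (Wᴴ * U) k.1 k.2).re * p k.2 := by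
    rw [Fintype.sum_prod_type_right, Matrix.trace, Complex.re_sum]
    refine Finset.sum_congr rfl fun i _ => ?_
    rw [Matrix.diag_apply, Matrix.mul_diagonal, Matrix.mul_apply, Finset.sum_mul, Complex.re_sum]
    simp [Matrix.conjTranspose_apply]
  have f2 : (Kᴴ * Q * K).trace.re = ∑ k : d × d, Complex.normSq (K k.1 k.2) * q k.1 := by
    rw [Fintype.sum_prod_type_right, Matrix.trace, Complex.re_sum]
    refine Finset.sum_congr rfl fun i _ => ?_
    rw [Matrix.diag_apply, Matrix.mul_apply, Complex.re_sum]
    refine Finset.sum_congr rfl fun j _ => ?_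
    rw [Matrix.mul_diagonal, Matrix.conjTranspose_apply]
    simp [Complex.normSq_apply]
    ring
  have f3 : (K * P * Kᴴ).trace.re = ∑ k : d × d, Complex.normSq (K k.1 k.2) * p k.2 := by
    rw [Fintype.sum_prod_type, Matrix.trace, Complex.re_sum]
    refine Finset.sum_congr rfl fun i _ => ?_
    rw [Matrix.diag_apply, Matrix.mul_apply, Complex.re_sum]
    refine Finset.sum_congr rfl fun j _ => ?_
    rw [Matrix.mul_diagonal, Matrix.conjTranspose_apply]
    simp [Complex.normSq_apply]
    ring
  rw [overlapFunctional, e1, e2, e3, f1, f2, f3, Finset.mul_sum, Finset.mul_sum,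
    ← Finset.sum_sub_distrib, ← Finset.sum_sub_distrib]
  exact Finset.sum_congr rfl fun k _ => by ring

/-- After multiplying by s, this is |sk − pc|² ≥ 0. -/
theorem two_mul_re_sub_le {s p : ℝ} (hs : 0 ≤ s) (h0 : s = 0 → p = 0) (k c : ℂ) :
    2 * (star k * c).re * p - Complex.normSq k * s ≤ Complex.normSq c * (p ^ 2 / s) := by
  rcases hs.eq_or_lt with hs | hs
  · simp [h0 hs.symm, ← hs]
  · rw [← mul_div_assoc, le_div_iff₀ hs]
    simp only [Complex.normSq_apply, Complex.mul_re, Complex.star_def, Complex.conj_re,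
      Complex.conj_im]
    nlinarith [sq_nonneg (s * k.re - p * c.re), sq_nonneg (s * k.im - p * c.im)]

theorem overlapFunctional_le (hρ : Diagonalizes U p ρ) (hσ : Diagonalizes W q σ)
    (hp : ∀ i, 0 ≤ p i) (hq : ∀ j, 0 ≤ q j) {t : ℝ} (ht : 0 < t) (Z : Matrix d d ℂ) :
    overlapFunctional t ρ σ Z ≤ ∑ k : d × d,
      Complex.normSq ((Wᴴ * U) k.1 k.2) * (p k.2 ^ 2 / (q k.1 + t * p k.2)) := by
  have hZ : Z = W * (Wᴴ * Z * U) * Uᴴ := by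
    calc Z = (W * Wᴴ) * Z * (U * Uᴴ) := by rw [hσ.unitary', hρ.unitary']; simp
      _ = _ := by simp only [Matrix.mul_assoc]
  rw [hZ, overlapFunctional_eq hρ hσ]
  refine Finset.sum_le_sum fun k _ => two_mul_re_sub_le ?_ (fun h => ?_) _ _
  · have := hp k.2; have := hq k.1; positivity
  · have h1 := hp k.2
    have h2 := hq k.1
    have h3 : t * p k.2 = 0 := by nlinarith [mul_nonneg ht.le h1]
    exact (mul_eq_zero.mp h3).resolve_left ht.ne'

theorem exists_overlapFunctional_eq (hρ : Diagonalizes U p ρ) (hσ : Diagonalizes W q σ) (t : ℝ) :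
    ∃ Z, overlapFunctional t ρ σ Z = ∑ k : d × d,
      Complex.normSq ((Wᴴ * U) k.1 k.2) * (p k.2 ^ 2 / (q k.1 + t * p k.2)) := by
  -- The entrywise maximizer k = pc/s of the scalar quadratic; where s = 0, division by zero makes
  -- both sides vanish.
  refine ⟨W * (Matrix.of fun j i => ((p i / (q j + t * p i) : ℝ) : ℂ) * (Wᴴ * U) j i) * Uᴴ, ?_⟩
  rw [overlapFunctional_eq hρ hσ]
  refine Finset.sum_congr rfl fun k _ => ?_
  rw [Matrix.of_apply]
  generalize (Wᴴ * U) k.1 k.2 = c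
  generalize q k.1 + t * p k.2 = s
  by_cases h0 : s = 0
  · simp [h0]
  · simp only [Complex.normSq_apply, Complex.mul_re, Complex.star_def, Complex.conj_re,
      Complex.conj_im, Complex.mul_im, Complex.ofReal_re, Complex.ofReal_im]
    field_simp
    ring

theorem sum_normSq_mul (hρ : Diagonalizes U p ρ) (hσ : Diagonalizes W q σ) (f : d → ℝ) :
    ∑ k : d × d, Complex.normSq ((Wᴴ * U) k.1 k.2) * f k.2 = ∑ i, f i := by
  rw [Fintype.sum_prod_type_right]
  refine Finset.sum_congr rfl fun i _ => ?_
  have h1 : (Wᴴ * U)ᴴ * (Wᴴ * U) = 1 := by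
    calc (Wᴴ * U)ᴴ * (Wᴴ * U) = Uᴴ * (W * Wᴴ) * U := by
          rw [Matrix.conjTranspose_mul, Matrix.conjTranspose_conjTranspose]
          simp only [Matrix.mul_assoc]
      _ = 1 := by rw [hσ.unitary', Matrix.mul_one, hρ.unitary]
  have h2 := congrArg Complex.re (congrFun (congrFun h1 i) i)
  rw [Matrix.mul_apply, Complex.re_sum, Matrix.one_apply_eq] at h2
  have h3 : ∑ j, Complex.normSq ((Wᴴ * U) j i) = 1 := by
    rw [← Complex.one_re, ← h2]
    refine Finset.sum_congr rfl fun j _ => ?_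
    simp [Complex.normSq_apply]
  change ∑ j, Complex.normSq ((Wᴴ * U) j i) * f i = f i
  rw [← Finset.sum_mul, h3, one_mul]

theorem sum_normSq_mul_apply (hρ : Diagonalizes U p ρ) (j : d) :
    ∑ i, Complex.normSq ((Wᴴ * U) j i) * p i = ((Wᴴ * ρ * W) j j).re := by
  have h1 : Wᴴ * ρ * W = (Wᴴ * U) * Matrix.diagonal (fun i => (p i : ℂ)) * (Wᴴ * U)ᴴ := by
    rw [hρ.eq, Matrix.conjTranspose_mul, Matrix.conjTranspose_conjTranspose]
    simp only [Matrix.mul_assoc]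
  rw [h1, Matrix.mul_apply, Complex.re_sum]
  refine Finset.sum_congr rfl fun i _ => ?_
  rw [Matrix.mul_diagonal, Matrix.conjTranspose_apply]
  simp [Complex.normSq_apply]
  ring

/-- A vanishing sum of nonnegative terms vanishes termwise. This turns the support condition on ρ
into the one needed for the scalar interpolation. -/
theorem normSq_mul_eq_zero (hρ : Diagonalizes U p ρ) (hp : ∀ i, 0 ≤ p i) {j : d}
    (hj : ((Wᴴ * ρ * W) j j).re = 0) (i : d) : Complex.normSq ((Wᴴ * U) j i) * p i = 0 := by
  rw [← sum_normSq_mul_apply hρ] at hj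
  exact (Finset.sum_eq_zero_iff_of_nonneg fun i _ =>
    mul_nonneg (Complex.normSq_nonneg _) (hp i)).mp hj i (Finset.mem_univ i)

end Variational

/-! ### Monotonicity of relative entropy -/

namespace QChannel

variable {a b e : Type*} [Fintype a] [Fintype b] [Fintype e] [DecidableEq a]

/-- The range projection P = VV† satisfies Tr A − Tr V†AV = Tr (1−P)A(1−P) ≥ 0. -/
theorem trace_conjTranspose_mul_mul_le {m k : Type*} [Fintype m] [Fintype k] [DecidableEq k]
    {V : Matrix m k ℂ} (hV : Vᴴ * V = 1) {A : Matrix m m ℂ} (hA : A.PosSemidef) :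
    (Vᴴ * A * V).trace.re ≤ A.trace.re := by
  classical
  have hP : (V * Vᴴ) * (V * Vᴴ) = V * Vᴴ := by
    calc (V * Vᴴ) * (V * Vᴴ) = V * (Vᴴ * V) * Vᴴ := by simp only [Matrix.mul_assoc]
      _ = _ := by rw [hV, Matrix.mul_one]
  have hPH : (1 - V * Vᴴ)ᴴ = 1 - V * Vᴴ := by
    simp [Matrix.conjTranspose_sub, Matrix.conjTranspose_mul]
  have h1 := (hA.conjTranspose_mul_mul_same (1 - V * Vᴴ)).trace_nonneg
  have h2 : ((1 - V * Vᴴ)ᴴ * A * (1 - V * Vᴴ)).trace = A.trace - (Vᴴ * A * V).trace := by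
    have hPP : (1 - V * Vᴴ) * (1 - V * Vᴴ) = 1 - V * Vᴴ := by
      rw [Matrix.sub_mul, Matrix.one_mul, Matrix.mul_sub, hP, Matrix.mul_one, sub_self, sub_zero]
    rw [hPH, Matrix.trace_mul_comm, ← Matrix.mul_assoc, hPP, Matrix.sub_mul,
      Matrix.one_mul, Matrix.trace_sub, Matrix.mul_assoc V, Matrix.trace_mul_comm V]
  rw [h2] at h1
  have h3 := (Complex.le_def.mp h1).1
  simp only [Complex.zero_re, Complex.sub_re] at h3
  linarith

-- The witness is the Heisenberg image V†(Z ⊗ 1)V. The linear term is preserved, while both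
-- quadratic terms, which enter negatively, can only shrink because VV† ≤ 1.
open scoped Kronecker in
theorem exists_overlapFunctional_map_le [DecidableEq b] (N : QChannel a b e)
    {ρ σ : Matrix a a ℂ} (hρ : ρ.PosSemidef) (hσ : σ.PosSemidef) {t : ℝ} (ht : 0 ≤ t)
    (Z : Matrix b b ℂ) :
    ∃ Y, overlapFunctional t (N.map ρ) (N.map σ) Z ≤ overlapFunctional t ρ σ Y := by
  classical
  set L : Matrix (b × e) (b × e) ℂ := Z ⊗ₖ (1 : Matrix e e ℂ) with hL
  have hLH : Lᴴ = Zᴴ ⊗ₖ (1 : Matrix e e ℂ) := by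
    rw [hL, Matrix.conjTranspose_kronecker, Matrix.conjTranspose_one]
  refine ⟨N.Vᴴ * L * N.V, ?_⟩
  have h1 : (Zᴴ * N.map ρ).trace = ((N.Vᴴ * L * N.V)ᴴ * ρ).trace := by
    rw [N.trace_mul_map, ← hLH, Matrix.conjTranspose_mul, Matrix.conjTranspose_mul,
      Matrix.conjTranspose_conjTranspose]
    calc (Lᴴ * (N.V * ρ * N.Vᴴ)).trace = ((Lᴴ * N.V * ρ) * N.Vᴴ).trace := by
          simp only [Matrix.mul_assoc]
      _ = _ := by rw [Matrix.trace_mul_comm]; simp only [Matrix.mul_assoc]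
  have h2 : ((N.Vᴴ * L * N.V)ᴴ * σ * (N.Vᴴ * L * N.V)).trace.re
      ≤ (Zᴴ * N.map σ * Z).trace.re := by
    have hA : (Lᴴ * (N.V * σ * N.Vᴴ) * L).PosSemidef :=
      (hσ.mul_mul_conjTranspose_same N.V).conjTranspose_mul_mul_same L
    have h3 := trace_conjTranspose_mul_mul_le N.isometry hA
    have h4 : (Zᴴ * N.map σ * Z).trace = (Lᴴ * (N.V * σ * N.Vᴴ) * L).trace := by
      rw [Matrix.trace_mul_comm, ← Matrix.mul_assoc, N.trace_mul_map, Matrix.trace_mul_comm _ L,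
        ← Matrix.mul_assoc L, hLH, hL, ← Matrix.mul_kronecker_mul, Matrix.one_mul]
    rw [h4]
    convert h3 using 3
    rw [Matrix.conjTranspose_mul, Matrix.conjTranspose_mul, Matrix.conjTranspose_conjTranspose]
    simp only [Matrix.mul_assoc]
  have h3 : ((N.Vᴴ * L * N.V) * ρ * (N.Vᴴ * L * N.V)ᴴ).trace.re
      ≤ (Z * N.map ρ * Zᴴ).trace.re := by
    have hA : (L * (N.V * ρ * N.Vᴴ) * Lᴴ).PosSemidef :=
      (hρ.mul_mul_conjTranspose_same N.V).mul_mul_conjTranspose_same L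
    have h3 := trace_conjTranspose_mul_mul_le N.isometry hA
    have h4 : (Z * N.map ρ * Zᴴ).trace = (L * (N.V * ρ * N.Vᴴ) * Lᴴ).trace := by
      rw [Matrix.trace_mul_comm, ← Matrix.mul_assoc, N.trace_mul_map, Matrix.trace_mul_comm _ Lᴴ,
        ← Matrix.mul_assoc Lᴴ, hLH, hL, ← Matrix.mul_kronecker_mul, Matrix.one_mul]
    rw [h4]
    convert h3 using 3
    rw [Matrix.conjTranspose_mul, Matrix.conjTranspose_mul, Matrix.conjTranspose_conjTranspose]
    simp only [Matrix.mul_assoc]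
  have h4 := mul_le_mul_of_nonneg_left h3 ht
  rw [overlapFunctional, overlapFunctional, h1]
  linarith

/-- Monotonicity of the relative entropy under channels. -/
theorem relativeEntropy_map_le [DecidableEq b] (N : QChannel a b e) {ρ σ : Matrix a a ℂ}
    (hρ : ρ.PosSemidef) (hσ : σ.PosSemidef) {W : Matrix a a ℂ} {q : a → ℝ}
    (h : Diagonalizes W q σ) {W' : Matrix b b ℂ} {q' : b → ℝ} (h' : Diagonalizes W' q' (N.map σ))
    (hs : ∀ j, q j = 0 → ((Wᴴ * ρ * W) j j).re = 0)
    (hs' : ∀ j, q' j = 0 → ((W'ᴴ * N.map ρ * W') j j).re = 0) :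
    -vonNeumannEntropy (N.map ρ) - ∑ j, ((W'ᴴ * N.map ρ * W') j j).re * Real.log (q' j)
      ≤ -vonNeumannEntropy ρ - ∑ j, ((Wᴴ * ρ * W) j j).re * Real.log (q j) := by
  have hρ' := N.posSemidef_map hρ
  have hσ' := N.posSemidef_map hσ
  have hU := hρ.1.diagonalizes
  have hU' := hρ'.1.diagonalizes
  set U := (hρ.1.eigenvectorUnitary : Matrix a a ℂ)
  set p := hρ.1.eigenvalues
  set U' := (hρ'.1.eigenvectorUnitary : Matrix b b ℂ)
  set p' := hρ'.1.eigenvalues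
  have hp := hU.nonneg hρ
  have hp' := hU'.nonneg hρ'
  -- The quantum problem becomes a scalar one over pairs of eigenvectors (j, i), weighted by their
  -- transition probabilities |⟨j|i⟩|².
  have key := sum_mul_log_sub_le
    (w := fun k : a × a => Complex.normSq ((Wᴴ * U) k.1 k.2)) (p := fun k => p k.2)
    (q := fun k => q k.1)
    (w' := fun k : b × b => Complex.normSq ((W'ᴴ * U') k.1 k.2)) (p' := fun k => p' k.2)
    (q' := fun k => q' k.1)
    (fun k => hp k.2) (fun k => h.nonneg hσ k.1) (fun k => hp' k.2) (fun k => h'.nonneg hσ' k.1)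
    (fun k hk => normSq_mul_eq_zero hU hp (hs k.1 hk) k.2)
    (fun k hk => normSq_mul_eq_zero hU' hp' (hs' k.1 hk) k.2)
    (by
      have h1 := hU.trace_eq
      have h2 := hU'.trace_eq
      rw [N.trace_map, h1] at h2
      rw [sum_normSq_mul hU h p, sum_normSq_mul hU' h' p']
      exact_mod_cast h2)
    (fun t ht => by
      obtain ⟨Z, hZ⟩ := exists_overlapFunctional_eq hU' h' t
      obtain ⟨Y, hY⟩ := N.exists_overlapFunctional_map_le hρ hσ ht.le Z
      exact hZ.symm.le.trans (hY.trans (overlapFunctional_le hU h hp (h.nonneg hσ) ht Y)))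
  simp only [mul_assoc] at key
  rw [sum_normSq_mul hU h fun i => p i * Real.log (p i),
    sum_normSq_mul hU' h' fun i => p' i * Real.log (p' i), Fintype.sum_prod_type,
    Fintype.sum_prod_type] at key
  simp only [← mul_assoc, ← Finset.sum_mul, sum_normSq_mul_apply hU,
    sum_normSq_mul_apply hU'] at key
  rw [hU.entropy_eq, hU'.entropy_eq]
  simp only [Real.negMulLog, neg_mul, Finset.sum_neg_distrib, neg_neg]
  exact key

end QChannel

/-! ### Marginals of distributions on products -/

section Marginal

variable {n : ℕ} {X : Fin n → Type*} [∀ i, Fintype (X i)]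

open Classical in
/-- The `i`-th marginal of a function on a product. -/
def marginal (p : (∀ i, X i) → ℝ) (i : Fin n) (k : X i) : ℝ :=
  ∑ x : ∀ i, X i, if x i = k then p x else 0

theorem sum_marginal_mul (p : (∀ i, X i) → ℝ) (i : Fin n) (f : X i → ℝ) :
    ∑ k, marginal p i k * f k = ∑ x : ∀ i, X i, p x * f (x i) := by
  simp only [marginal, Finset.sum_mul]
  rw [Finset.sum_comm]
  refine Finset.sum_congr rfl fun x _ => ?_
  rw [Finset.sum_eq_single (x i) (fun k _ hk => by rw [if_neg hk.symm, zero_mul])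
    (fun h => absurd (Finset.mem_univ _) h), if_pos rfl]

theorem marginal_mem_stdSimplex {p : (∀ i, X i) → ℝ} (hp : p ∈ stdSimplex ℝ (∀ i, X i))
    (i : Fin n) : marginal p i ∈ stdSimplex ℝ (X i) := by
  refine ⟨fun k => Finset.sum_nonneg fun x _ => ?_, ?_⟩
  · split_ifs
    exacts [hp.1 x, le_rfl]
  · have h := sum_marginal_mul p i fun _ => 1
    simp only [mul_one] at h
    rw [h, hp.2]

theorem sum_prod_mul_apply {p : ∀ i, X i → ℝ} (hp : ∀ i, ∑ k, p i k = 1) (i : Fin n)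
    (f : X i → ℝ) : ∑ x : ∀ i, X i, (∏ j, p j (x j)) * f (x i) = ∑ k, p i k * f k := by
  -- Absorbing f into the i-th factor gives a pure product, so the sum factors and all other factors
  -- equal 1.
  have h1 : ∀ x : ∀ i, X i, (∏ j, p j (x j)) * f (x i)
      = ∏ j, p j (x j) * Function.update (fun (j : Fin n) (_ : X j) => (1 : ℝ)) i f j (x j) := by
    intro x
    rw [Finset.prod_mul_distrib]
    congr 1
    rw [Finset.prod_eq_single i]
    · simp
    · intro j _ hj
      simp [Function.update_of_ne hj]
    · simp
  have h2 := Finset.prod_univ_sum (fun j => (Finset.univ : Finset (X j)))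
    fun j k => p j k * Function.update (fun (j : Fin n) (_ : X j) => (1 : ℝ)) i f j k
  rw [Fintype.piFinset_univ] at h2
  rw [Finset.sum_congr rfl fun x _ => h1 x, ← h2, Finset.prod_eq_single i]
  · simp
  · intro j _ hj
    simp [Function.update_of_ne hj, hp]
  · simp

theorem prodProb_mem_stdSimplex {p : ∀ i, X i → ℝ} (hp : ∀ i, p i ∈ stdSimplex ℝ (X i)) :
    prodProb p ∈ stdSimplex ℝ (∀ i, X i) := by
  refine ⟨fun x => Finset.prod_nonneg fun i _ => (hp i).1 _, ?_⟩
  have h := Finset.prod_univ_sum (fun j => (Finset.univ : Finset (X j))) fun j k => p j k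
  rw [Fintype.piFinset_univ] at h
  simp only [prodProb]
  rw [← h]
  exact Finset.prod_eq_one fun i _ => (hp i).2

theorem marginal_prodProb {p : ∀ i, X i → ℝ} (hp : ∀ i, p i ∈ stdSimplex ℝ (X i)) (i : Fin n) :
    marginal (prodProb p) i = p i := by
  classical
  funext k
  have h1 := sum_marginal_mul (prodProb p) i (Pi.single k 1)
  have h2 := sum_prod_mul_apply (fun i => (hp i).2) i (Pi.single k (1 : ℝ))
  simp only [prodProb] at h1
  rw [h2] at h1
  simpa [Pi.single_apply] using h1

theorem sum_mul_log_prod {r : Type*} [Fintype r] {p : (∀ i, X i) → ℝ} (hp : ∀ x, 0 ≤ p x)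
    {m : ∀ i, X i → r → ℝ} (hm : ∀ i k j, 0 ≤ m i k j) (hm1 : ∀ i k, ∑ j, m i k j = 1)
    {q : Fin n → r → ℝ} (hq : ∀ i j, q i j = ∑ x : ∀ i, X i, p x * m i (x i) j) :
    ∑ j : Fin n → r, (∑ x : ∀ i, X i, p x * ∏ i, m i (x i) (j i)) * Real.log (∏ i, q i (j i))
      = ∑ i, ∑ k, q i k * Real.log (q i k) := by
  -- The logarithm splits only when all factors are nonzero. A nonzero joint weight forces this for
  -- its marginals; otherwise the coefficient is zero.
  have h1 : ∀ j : Fin n → r,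
      (∑ x : ∀ i, X i, p x * ∏ i, m i (x i) (j i)) * Real.log (∏ i, q i (j i))
      = (∑ x : ∀ i, X i, p x * ∏ i, m i (x i) (j i)) * ∑ i, Real.log (q i (j i)) := by
    intro j
    by_cases h0 : ∑ x : ∀ i, X i, p x * ∏ i, m i (x i) (j i) = 0
    · rw [h0, zero_mul, zero_mul]
    · obtain ⟨x, -, hx⟩ := Finset.exists_ne_zero_of_sum_ne_zero h0
      rw [Real.log_prod]
      intro i _
      have h2 : p x * m i (x i) (j i) ≠ 0 :=
        mul_ne_zero (left_ne_zero_of_mul hx)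
          (Finset.prod_ne_zero_iff.mp (right_ne_zero_of_mul hx) i (Finset.mem_univ i))
      rw [hq]
      intro h3
      exact h2 ((Finset.sum_eq_zero_iff_of_nonneg fun y _ =>
        mul_nonneg (hp y) (hm i (y i) (j i))).mp h3 x (Finset.mem_univ x))
  calc _ = ∑ j : Fin n → r, ∑ i, ∑ x : ∀ i, X i,
        p x * ((∏ k, m k (x k) (j k)) * Real.log (q i (j i))) := by
        refine Finset.sum_congr rfl fun j _ => ?_
        rw [h1, Finset.mul_sum]
        refine Finset.sum_congr rfl fun i _ => ?_
        rw [Finset.sum_mul]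
        exact Finset.sum_congr rfl fun x _ => mul_assoc _ _ _
    _ = ∑ i, ∑ x : ∀ i, X i, p x * ∑ k, m i (x i) k * Real.log (q i k) := by
        rw [Finset.sum_comm]
        refine Finset.sum_congr rfl fun i _ => ?_
        rw [Finset.sum_comm]
        refine Finset.sum_congr rfl fun x _ => ?_
        rw [← Finset.mul_sum]
        congr 1
        exact sum_prod_mul_apply (X := fun _ => r) (p := fun k => m k (x k))
          (fun k => hm1 k (x k)) i fun j => Real.log (q i j)
    _ = _ := by
        refine Finset.sum_congr rfl fun i _ => ?_
        simp only [Finset.mul_sum]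
        rw [Finset.sum_comm]
        refine Finset.sum_congr rfl fun k _ => ?_
        rw [hq, Finset.sum_mul]
        exact Finset.sum_congr rfl fun x _ => (mul_assoc _ _ _).symm

end Marginal

/-! ### Entropies and cross terms of averages and products -/

section Entropy

variable {n : ℕ} {r : Type*} [Fintype r]

theorem re_averageState_conj_apply {Y : Type*} [Fintype Y] (p : Y → ℝ) (M : Y → Matrix r r ℂ)
    (W : Matrix r r ℂ) (j : r) :
    ((Wᴴ * averageState p M * W) j j).re = ∑ x, p x * ((Wᴴ * M x * W) j j).re := by
  simp [averageState, Matrix.mul_sum, Matrix.sum_mul, Matrix.sum_apply]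

theorem conj_prodState_apply {X : Fin n → Type*} {M : ∀ i, X i → Matrix r r ℂ}
    (hM : ∀ i k, (M i k).PosSemidef)
    (W : Fin n → Matrix r r ℂ) (x : ∀ i, X i) (j : Fin n → r) :
    (((tensorMatrix W)ᴴ * prodState M x * tensorMatrix W) j j).re
      = ∏ i, (((W i)ᴴ * M i (x i) * W i) (j i) (j i)).re := by
  rw [prodState, tensorMatrix_conjTranspose, tensorMatrix_mul, tensorMatrix_mul]
  -- Positivity makes these entries real, so taking real parts commutes with the product.
  have h1 : ∀ i, ((W i)ᴴ * M i (x i) * W i) (j i) (j i)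
      = (((((W i)ᴴ * M i (x i) * W i) (j i) (j i)).re : ℝ) : ℂ) := by
    intro i
    exact Complex.eq_re_of_ofReal_le
      (r := 0) (by simpa using ((hM i (x i)).conjTranspose_mul_mul_same (W i)).diag_nonneg)
  simp only [tensorMatrix, Matrix.of_apply]
  rw [Finset.prod_congr rfl fun i _ => h1 i, ← Complex.ofReal_prod, Complex.ofReal_re]

variable [DecidableEq r]

/-- Additivity of the entropy on tensor products. -/
theorem vonNeumannEntropy_tensorMatrix {σ : Fin n → Matrix r r ℂ}
    (h : ∀ i, IsDensityMatrix (σ i)) :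
    vonNeumannEntropy (tensorMatrix σ) = ∑ i, vonNeumannEntropy (σ i) := by
  have hd := fun i => (h i).1.1.diagonalizes
  rw [(Diagonalizes.tensor hd).entropy_eq]
  have h1 := sum_mul_log_prod (X := fun _ : Fin n => Unit) (p := fun _ => 1)
    (m := fun i _ => (h i).1.1.eigenvalues) (q := fun i => (h i).1.1.eigenvalues)
    (fun _ => zero_le_one) (fun i _ => (hd i).nonneg (h i).1) (fun i _ => (hd i).sum_eq_one (h i))
    (fun i j => by simp)
  simp only [one_mul, Finset.univ_unique, Finset.sum_singleton] at h1
  simp only [Real.negMulLog, neg_mul, Finset.sum_neg_distrib, h1, (hd _).entropy_eq]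

theorem Diagonalizes.eq_sum_average {Y : Type*} [Fintype Y] {p : Y → ℝ} {M : Y → Matrix r r ℂ}
    {W : Matrix r r ℂ} {q : r → ℝ} (h : Diagonalizes W q (averageState p M)) (j : r) :
    q j = ∑ x, p x * ((Wᴴ * M x * W) j j).re := by
  have h1 := congrArg Complex.re (congrFun (congrFun h.conj_eq j) j)
  rw [Matrix.diagonal_apply_eq, Complex.ofReal_re, re_averageState_conj_apply] at h1
  exact h1.symm

/-- The average dominates each pₓMₓ, which controls supports, and Tr Mₓ log σ is linear in Mₓ. These
facts express the Holevo quantity as a mean relative entropy to the average. -/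
theorem average_cross_term {Y : Type*} [Fintype Y] {p : Y → ℝ} (hp : ∀ x, 0 ≤ p x)
    {M : Y → Matrix r r ℂ} (hM : ∀ x, (M x).PosSemidef) {W : Matrix r r ℂ} {q : r → ℝ}
    (h : Diagonalizes W q (averageState p M)) :
    (∀ x, p x ≠ 0 → ∀ j, q j = 0 → ((Wᴴ * M x * W) j j).re = 0) ∧
    ∑ x, p x * ∑ j, ((Wᴴ * M x * W) j j).re * Real.log (q j)
      = -vonNeumannEntropy (averageState p M) := by
  have hnn : ∀ x j, 0 ≤ ((Wᴴ * M x * W) j j).re := fun x j =>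
    (Complex.le_def.mp ((hM x).conjTranspose_mul_mul_same W).diag_nonneg).1
  constructor
  · intro x hx j hj
    rw [h.eq_sum_average] at hj
    exact (mul_eq_zero.mp ((Finset.sum_eq_zero_iff_of_nonneg fun y _ =>
      mul_nonneg (hp y) (hnn y j)).mp hj x (Finset.mem_univ x))).resolve_left hx
  · simp only [h.entropy_eq, Real.negMulLog, Finset.mul_sum, neg_mul, Finset.sum_neg_distrib,
      neg_neg]
    rw [Finset.sum_comm]
    refine Finset.sum_congr rfl fun j _ => ?_
    simp only [← mul_assoc]
    rw [← Finset.sum_mul, ← h.eq_sum_average]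

variable {X : Fin n → Type*} [∀ i, Fintype (X i)]

/-- Data for the cross term of the relative entropy between a state that is separable with
respect to the `n` systems and the product of its reduced states. -/
theorem separable_cross_term {p : (∀ i, X i) → ℝ} (hp : p ∈ stdSimplex ℝ (∀ i, X i))
    {M : ∀ i, X i → Matrix r r ℂ} (hM : ∀ i k, IsDensityMatrix (M i k))
    {W : Fin n → Matrix r r ℂ} {q : Fin n → r → ℝ}
    (h : ∀ i, Diagonalizes (W i) (q i) (averageState (marginal p i) (M i))) :
    (∀ j : Fin n → r, ∏ i, q i (j i) = 0 →
      (((tensorMatrix W)ᴴ * averageState p (prodState M) * tensorMatrix W) j j).re = 0) ∧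
    ∑ j : Fin n → r,
      (((tensorMatrix W)ᴴ * averageState p (prodState M) * tensorMatrix W) j j).re
        * Real.log (∏ i, q i (j i))
      = -∑ i, vonNeumannEntropy (averageState (marginal p i) (M i)) := by
  set m : ∀ i, X i → r → ℝ := fun i k j => (((W i)ᴴ * M i k * W i) j j).re with hm
  have hm0 : ∀ i k j, 0 ≤ m i k j := fun i k j =>
    (Complex.le_def.mp ((hM i k).1.conjTranspose_mul_mul_same (W i)).diag_nonneg).1
  have hm1 : ∀ i k, ∑ j, m i k j = 1 := by
    intro i k
    have h1 : ((W i)ᴴ * M i k * W i).trace = 1 := by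
      rw [Matrix.trace_mul_comm, ← Matrix.mul_assoc, (h i).unitary', Matrix.one_mul, (hM i k).2]
    have h2 := congrArg Complex.re h1
    rwa [Matrix.trace, Complex.re_sum] at h2
  have hq : ∀ i j, q i j = ∑ x : ∀ i, X i, p x * m i (x i) j := by
    intro i j
    rw [(h i).eq_sum_average]
    exact sum_marginal_mul p i fun k => m i k j
  have hr : ∀ j, (((tensorMatrix W)ᴴ * averageState p (prodState M) * tensorMatrix W) j j).re
      = ∑ x : ∀ i, X i, p x * ∏ i, m i (x i) (j i) := by
    intro j
    rw [re_averageState_conj_apply]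
    exact Finset.sum_congr rfl fun x _ => by rw [conj_prodState_apply fun i k => (hM i k).1]
  constructor
  · intro j hj
    obtain ⟨i, -, hi⟩ := Finset.prod_eq_zero_iff.mp hj
    rw [hr]
    rw [hq] at hi
    refine Finset.sum_eq_zero fun x _ => ?_
    have h1 := (Finset.sum_eq_zero_iff_of_nonneg fun y _ =>
      mul_nonneg (hp.1 y) (hm0 i (y i) (j i))).mp hi x (Finset.mem_univ x)
    rcases mul_eq_zero.mp h1 with h1 | h1
    · rw [h1, zero_mul]
    · rw [Finset.prod_eq_zero (Finset.mem_univ i) h1, mul_zero]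
  · simp only [hr]
    rw [sum_mul_log_prod hp.1 hm0 hm1 hq, ← Finset.sum_neg_distrib]
    refine Finset.sum_congr rfl fun i _ => ?_
    rw [(h i).entropy_eq]
    simp [Real.negMulLog]

end Entropy

/-! ### Entropy inequalities for post-processing -/

namespace QChannel

variable {a b e : Type*} [Fintype a] [Fintype b] [Fintype e] [DecidableEq a]

theorem tensorPow_map_average {n : ℕ} {X : Fin n → Type*} [∀ i, Fintype (X i)]
    (N : QChannel a b e) (p : (∀ i, X i) → ℝ) (M : ∀ i, X i → Matrix a a ℂ) :
    (N.tensorPow n).map (averageState p (prodState M))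
      = averageState p (prodState fun i k => N.map (M i k)) := by
  rw [map_averageState]
  congr 1
  funext x
  exact N.tensorPow_map_tensorMatrix fun i => M i (x i)

/-- For separable states, the entropy lost through `n` uses of a channel is at most the sum of the
losses of the reduced states. -/
theorem entropy_sub_tensorPow_le [DecidableEq b] {n : ℕ} {X : Fin n → Type*}
    [∀ i, Fintype (X i)] (D : QChannel a b e) {p : (∀ i, X i) → ℝ}
    (hp : p ∈ stdSimplex ℝ (∀ i, X i)) {M : ∀ i, X i → Matrix a a ℂ}
    (hM : ∀ i k, IsDensityMatrix (M i k)) :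
    vonNeumannEntropy (averageState p (prodState M))
        - vonNeumannEntropy ((D.tensorPow n).map (averageState p (prodState M)))
      ≤ ∑ i, (vonNeumannEntropy (averageState (marginal p i) (M i))
        - vonNeumannEntropy (D.map (averageState (marginal p i) (M i)))) := by
  have hM' : ∀ i k, IsDensityMatrix (D.map (M i k)) := fun i k => D.isDensityMatrix_map (hM i k)
  have hmarg := fun i => IsDensityMatrix.average (marginal_mem_stdSimplex hp i) (hM i)
  have hmarg' : ∀ i, IsDensityMatrix (averageState (marginal p i) fun k => D.map (M i k)) :=
    fun i => IsDensityMatrix.average (marginal_mem_stdSimplex hp i) (hM' i)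
  have hW := fun i => (hmarg i).1.1.diagonalizes
  have hW' := fun i => (hmarg' i).1.1.diagonalizes
  have hω : IsDensityMatrix (averageState p (prodState M)) :=
    IsDensityMatrix.average hp fun x => IsDensityMatrix.tensor fun i => hM i (x i)
  have c := separable_cross_term hp hM hW
  have c' := separable_cross_term hp hM' hW'
  have hmap : (D.tensorPow n).map (tensorMatrix fun i => averageState (marginal p i) (M i))
      = tensorMatrix fun i => averageState (marginal p i) fun k => D.map (M i k) := by
    rw [tensorPow_map_tensorMatrix]
    simp only [map_averageState]
  -- The relative entropy of ω to the product of its marginals is ∑ S(ωᵢ) − S(ω), and the tensor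
  -- power sends that product to the product of the output marginals.
  have key := (D.tensorPow n).relativeEntropy_map_le hω.1
    (IsDensityMatrix.tensor hmarg).1 (Diagonalizes.tensor hW)
    (hmap ▸ Diagonalizes.tensor hW') c.1 (by rw [tensorPow_map_average]; exact c'.1)
  rw [c.2, tensorPow_map_average, c'.2] at key
  rw [Finset.sum_sub_distrib, tensorPow_map_average]
  simp only [map_averageState]
  linarith

/-- Monotonicity of the Holevo quantity under post-processing. -/
theorem holevo_postprocess_le [DecidableEq b] {X : Type*} [Fintype X] (D : QChannel a b e)
    {p : X → ℝ} (hp : p ∈ stdSimplex ℝ X) {M : X → Matrix a a ℂ}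
    (hM : ∀ x, IsDensityMatrix (M x)) :
    D.holevo p M ≤ vonNeumannEntropy (averageState p M) - ∑ x, p x * vonNeumannEntropy (M x) := by
  have havg := IsDensityMatrix.average hp hM
  have hM' := fun x => D.isDensityMatrix_map (hM x)
  have hW := havg.1.1.diagonalizes
  have havg' : IsDensityMatrix (averageState p fun x => D.map (M x)) :=
    IsDensityMatrix.average hp hM'
  have hW' := havg'.1.1.diagonalizes
  have c := average_cross_term hp.1 (fun x => (hM x).1) hW
  have c' := average_cross_term hp.1 (fun x => (hM' x).1) hW'
  -- Letters of probability zero are set aside, since their supports need not lie in that of the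
  -- average.
  have mul_le : ∀ x {u v : ℝ}, (p x ≠ 0 → u ≤ v) → p x * u ≤ p x * v := by
    intro x u v huv
    by_cases hx : p x = 0
    · rw [hx, zero_mul, zero_mul]
    · exact mul_le_mul_of_nonneg_left (huv hx) (hp.1 x)
  have key := Finset.sum_le_sum fun x (_ : x ∈ Finset.univ) => mul_le x fun hx =>
    D.relativeEntropy_map_le (hM x).1 havg.1 hW (by rw [map_averageState]; exact hW')
      (c.1 x hx) (c'.1 x hx)
  simp only [mul_sub, mul_neg, Finset.sum_sub_distrib, Finset.sum_neg_distrib, c.2, c'.2] at key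
  rw [holevo, map_averageState]
  linarith

end QChannel

/-! ### Continuity of the entropy -/

section Continuity

theorem continuous_averageState {d X : Type*} [Fintype X] (M : X → Matrix d d ℂ) :
    Continuous fun p : X → ℝ => averageState p M := by
  refine continuous_finsetSum _ fun x _ => ?_
  exact (Complex.continuous_ofReal.comp (continuous_apply x)).smul continuous_const

variable {d : Type*} [Fintype d] [DecidableEq d]

-- All density matrices have spectrum in the compact interval [0, 1], where −x log x is continuous,
-- so the functional calculus is continuous there.
open scoped Matrix.Norms.L2Operator in
theorem continuousOn_vonNeumannEntropy :
    ContinuousOn (vonNeumannEntropy (a := d)) {σ | IsDensityMatrix σ} := by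
  have h1 : ContinuousOn (fun σ : Matrix d d ℂ => cfc Real.negMulLog σ) {σ | IsDensityMatrix σ} := by
    refine ContinuousOn.cfc' (isCompact_Icc (a := (0 : ℝ)) (b := 1)) Real.negMulLog continuousOn_id
      (fun σ hσ => ?_) (fun σ hσ => hσ.1.1) Real.continuous_negMulLog.continuousOn
    have hd := hσ.1.1.diagonalizes
    rw [hσ.1.1.spectrum_real_eq_range_eigenvalues]
    rintro _ ⟨j, rfl⟩
    refine ⟨hd.nonneg hσ.1 j, ?_⟩
    rw [← hd.sum_eq_one hσ]
    exact Finset.single_le_sum (fun i _ => hd.nonneg hσ.1 i) (Finset.mem_univ j)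
  have h2 : Continuous fun σ : Matrix d d ℂ => σ.trace.re := by
    refine Complex.continuous_re.comp ?_
    exact continuous_id.matrix_trace
  exact h2.comp_continuousOn h1

end Continuity

/-! ### Product ensembles and the total Hamiltonian -/

section Product

variable {n : ℕ} {X : Fin n → Type*} [∀ i, Fintype (X i)] {r : Type*}

theorem averageState_prod (p : ∀ i, X i → ℝ) (M : ∀ i, X i → Matrix r r ℂ) :
    averageState (prodProb p) (prodState M) = tensorMatrix fun i => averageState (p i) (M i) := by
  ext y z
  simp only [averageState, prodProb, prodState, tensorMatrix, Matrix.sum_apply, Matrix.smul_apply,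
    Matrix.of_apply, smul_eq_mul, Complex.ofReal_prod, ← Finset.prod_mul_distrib]
  rw [Finset.prod_univ_sum, Fintype.piFinset_univ]

theorem trace_totalHamiltonian_mul [Fintype r] [DecidableEq r] (H : Matrix r r ℂ)
    {σ : Fin n → Matrix r r ℂ} (hσ : ∀ i, (σ i).trace = 1) :
    (totalHamiltonian n H * tensorMatrix σ).trace = ∑ i, (H * σ i).trace := by
  rw [totalHamiltonian, Matrix.sum_mul, Matrix.trace_sum]
  refine Finset.sum_congr rfl fun i _ => ?_
  rw [tensorMatrix_mul, tensorMatrix_trace, Finset.prod_eq_single i]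
  · simp
  · intro j _ hj
    simp [Function.update_of_ne hj, hσ]
  · simp

end Product

/-! ### Energy and private information over several uses -/

namespace QChannel

variable {a b e : Type*} [Fintype a] [Fintype b] [Fintype e]
  [DecidableEq a] {X : Type*} [Fintype X]

theorem outputEnergy_eq_sum (N : QChannel a b e) (H : Matrix b b ℂ) (p : X → ℝ)
    (ρ : X → Matrix a a ℂ) :
    N.outputEnergy H p ρ = ∑ x, p x * (H * N.map (ρ x)).trace.re := by
  rw [outputEnergy, map_averageState]
  simp [averageState, Matrix.mul_sum, Matrix.trace_sum]

theorem outputEnergy_tensorPow [DecidableEq b] {n : ℕ} {X : Fin n → Type*} [∀ i, Fintype (X i)]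
    (N : QChannel a b e) (H : Matrix b b ℂ) (p : (∀ i, X i) → ℝ) {σ : ∀ i, X i → Matrix a a ℂ}
    (hσ : ∀ i k, IsDensityMatrix (σ i k)) :
    (N.tensorPow n).outputEnergy (totalHamiltonian n H) p (prodState σ)
      = ∑ i, N.outputEnergy H (marginal p i) (σ i) := by
  simp only [outputEnergy_eq_sum, sum_marginal_mul]
  rw [Finset.sum_comm]
  refine Finset.sum_congr rfl fun x _ => ?_
  rw [prodState, tensorPow_map_tensorMatrix,
    trace_totalHamiltonian_mul H fun i => (N.isDensityMatrix_map (hσ i (x i))).2, Complex.re_sum,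
    Finset.mul_sum]

variable [DecidableEq b]

theorem continuousOn_holevo (N : QChannel a b e) {ρ : X → Matrix a a ℂ}
    (hρ : ∀ x, IsDensityMatrix (ρ x)) :
    ContinuousOn (fun p => N.holevo p ρ) (stdSimplex ℝ X) := by
  refine ContinuousOn.sub ?_ (Continuous.continuousOn ?_)
  · simp only [map_averageState]
    exact continuousOn_vonNeumannEntropy.comp (continuous_averageState _).continuousOn
      fun p hp => IsDensityMatrix.average hp fun x => N.isDensityMatrix_map (hρ x)
  · exact continuous_finsetSum _ fun x _ => (continuous_apply x).mul continuous_const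

theorem holevo_tensorPow_prod {n : ℕ} {X : Fin n → Type*} [∀ i, Fintype (X i)]
    (N : QChannel a b e) {p : ∀ i, X i → ℝ} (hp : ∀ i, p i ∈ stdSimplex ℝ (X i))
    {σ : ∀ i, X i → Matrix a a ℂ} (hσ : ∀ i k, IsDensityMatrix (σ i k)) :
    (N.tensorPow n).holevo (prodProb p) (prodState σ) = ∑ i, N.holevo (p i) (σ i) := by
  have h1 : ∀ x : ∀ i, X i, vonNeumannEntropy ((N.tensorPow n).map (prodState σ x))
      = ∑ i, vonNeumannEntropy (N.map (σ i (x i))) := by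
    intro x
    rw [prodState, tensorPow_map_tensorMatrix,
      vonNeumannEntropy_tensorMatrix fun i => N.isDensityMatrix_map (hσ i (x i))]
  simp only [holevo, Finset.sum_sub_distrib, h1]
  rw [averageState_prod, tensorPow_map_tensorMatrix, vonNeumannEntropy_tensorMatrix fun i =>
    N.isDensityMatrix_map (IsDensityMatrix.average (hp i) (hσ i))]
  congr 1
  simp only [Finset.mul_sum]
  rw [Finset.sum_comm]
  refine Finset.sum_congr rfl fun i _ => ?_
  exact sum_prod_mul_apply (fun i => (hp i).2) i fun k => vonNeumannEntropy (N.map (σ i k))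

variable [DecidableEq e]

theorem continuousOn_privateInfo (N : QChannel a b e) {ρ : X → Matrix a a ℂ}
    (hρ : ∀ x, IsDensityMatrix (ρ x)) :
    ContinuousOn (fun p => N.privateInfo p ρ) (stdSimplex ℝ X) :=
  (N.continuousOn_holevo hρ).sub (N.complementary.continuousOn_holevo hρ)

theorem privateInfo_eq (N : QChannel a b e) (p : X → ℝ) (ρ : X → Matrix a a ℂ) :
    N.privateInfo p ρ = (vonNeumannEntropy (N.map (averageState p ρ))
        - vonNeumannEntropy (N.complementary.map (averageState p ρ)))
      - ∑ x, p x * (vonNeumannEntropy (N.map (ρ x))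
        - vonNeumannEntropy (N.complementary.map (ρ x))) := by
  simp only [privateInfo, holevo, mul_sub, Finset.sum_sub_distrib]
  ring

theorem privateInfo_le (N : QChannel a b e) {p : X → ℝ} (hp : p ∈ stdSimplex ℝ X)
    {ρ : X → Matrix a a ℂ} (hρ : ∀ x, IsDensityMatrix (ρ x)) :
    N.privateInfo p ρ ≤ Fintype.card b + Fintype.card e := by
  have h := IsDensityMatrix.average hp hρ
  have h1 := (N.isDensityMatrix_map h).entropy_le
  have h2 := (N.complementary.isDensityMatrix_map h).entropy_nonneg
  have h3 : 0 ≤ ∑ x, p x * vonNeumannEntropy (N.map (ρ x)) :=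
    Finset.sum_nonneg fun x _ =>
      mul_nonneg (hp.1 x) (N.isDensityMatrix_map (hρ x)).entropy_nonneg
  have h4 : ∑ x, p x * vonNeumannEntropy (N.complementary.map (ρ x)) ≤ Fintype.card e := by
    calc _ ≤ ∑ x, p x * (Fintype.card e : ℝ) := Finset.sum_le_sum fun x _ =>
          mul_le_mul_of_nonneg_left (N.complementary.isDensityMatrix_map (hρ x)).entropy_le (hp.1 x)
      _ = Fintype.card e := by rw [← Finset.sum_mul, hp.2, one_mul]
  rw [privateInfo, holevo, holevo]
  linarith

theorem privateInfo_tensorPow_prod {n : ℕ} {X : Fin n → Type*} [∀ i, Fintype (X i)]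
    (N : QChannel a b e) {p : ∀ i, X i → ℝ} (hp : ∀ i, p i ∈ stdSimplex ℝ (X i))
    {σ : ∀ i, X i → Matrix a a ℂ} (hσ : ∀ i k, IsDensityMatrix (σ i k)) :
    (N.tensorPow n).privateInfo (prodProb p) (prodState σ) = ∑ i, N.privateInfo (p i) (σ i) := by
  simp only [privateInfo, complementary_tensorPow, holevo_tensorPow_prod _ hp hσ,
    Finset.sum_sub_distrib]

/-- Private information is subadditive over the uses of a degradable channel. -/
theorem Degradable.privateInfo_tensorPow_le {n : ℕ} {X : Fin n → Type*} [∀ i, Fintype (X i)]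
    {N : QChannel a b e} (hN : N.Degradable) {p : (∀ i, X i) → ℝ}
    (hp : p ∈ stdSimplex ℝ (∀ i, X i)) {σ : ∀ i, X i → Matrix a a ℂ}
    (hσ : ∀ i k, IsDensityMatrix (σ i k)) :
    (N.tensorPow n).privateInfo p (prodState σ)
      ≤ ∑ i, N.privateInfo (marginal p i) (σ i) := by
  obtain ⟨r, D, hD⟩ := hN
  -- Applied to the outputs of N, the loss under the degrading channel is S(B) − S(E) at the average
  -- state. The signal terms, on product states, are exactly additive.
  have h1 := D.entropy_sub_tensorPow_le hp (M := fun i k => N.map (σ i k))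
    fun i k => N.isDensityMatrix_map (hσ i k)
  rw [tensorPow_map_average] at h1
  simp only [← hD, ← map_averageState] at h1
  rw [← tensorPow_map_average, ← tensorPow_map_average, ← complementary_tensorPow] at h1
  have h2 : ∀ x : ∀ i, X i, vonNeumannEntropy ((N.tensorPow n).map (prodState σ x))
        - vonNeumannEntropy ((N.tensorPow n).complementary.map (prodState σ x))
      = ∑ i, (vonNeumannEntropy (N.map (σ i (x i)))
        - vonNeumannEntropy (N.complementary.map (σ i (x i)))) := by
    intro x
    rw [complementary_tensorPow, prodState, tensorPow_map_tensorMatrix, tensorPow_map_tensorMatrix,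
      vonNeumannEntropy_tensorMatrix fun i => N.isDensityMatrix_map (hσ i (x i)),
      vonNeumannEntropy_tensorMatrix fun i => N.complementary.isDensityMatrix_map (hσ i (x i)),
      Finset.sum_sub_distrib]
  have h3 : ∑ x : ∀ i, X i, p x * ∑ i, (vonNeumannEntropy (N.map (σ i (x i)))
        - vonNeumannEntropy (N.complementary.map (σ i (x i))))
      = ∑ i, ∑ k, marginal p i k * (vonNeumannEntropy (N.map (σ i k))
        - vonNeumannEntropy (N.complementary.map (σ i k))) := by
    simp only [sum_marginal_mul p _ fun k => vonNeumannEntropy (N.map (σ _ k))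
      - vonNeumannEntropy (N.complementary.map (σ _ k)), Finset.mul_sum]
    exact Finset.sum_comm
  simp only [privateInfo_eq, h2]
  rw [h3, Finset.sum_sub_distrib]
  linarith

/-- Private information of a degradable channel is concave in the input distribution. -/
theorem Degradable.concaveOn_privateInfo {N : QChannel a b e} (hN : N.Degradable)
    {ρ : X → Matrix a a ℂ} (hρ : ∀ x, IsDensityMatrix (ρ x)) :
    ConcaveOn ℝ (stdSimplex ℝ X) fun p => N.privateInfo p ρ := by
  obtain ⟨r, D, hD⟩ := hN
  refine ⟨convex_stdSimplex ℝ X, fun p hp p' hp' s t hs ht hst => ?_⟩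
  have hM : ∀ k : Fin 2,
      IsDensityMatrix (![N.map (averageState p ρ), N.map (averageState p' ρ)] k) := by
    intro k
    fin_cases k
    exacts [N.isDensityMatrix_map (IsDensityMatrix.average hp hρ),
      N.isDensityMatrix_map (IsDensityMatrix.average hp' hρ)]
  have hq : ![s, t] ∈ stdSimplex ℝ (Fin 2) := by
    refine ⟨fun k => ?_, by simpa using hst⟩
    fin_cases k
    exacts [hs, ht]
  have hmix : averageState (s • p + t • p') ρ
      = (s : ℂ) • averageState p ρ + (t : ℂ) • averageState p' ρ := by
    simp only [averageState, Finset.smul_sum, ← Finset.sum_add_distrib, smul_smul, ← add_smul]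
    simp
  have havg : averageState ![s, t] ![N.map (averageState p ρ), N.map (averageState p' ρ)]
      = N.map (averageState (s • p + t • p') ρ) := by
    rw [hmix]
    generalize averageState p ρ = A
    generalize averageState p' ρ = A'
    simp [averageState, map_eq_sum_kraus, Matrix.mul_add, Matrix.add_mul, Finset.sum_add_distrib,
      Finset.smul_sum]
  -- For the two output averages with weights s and t, monotonicity of the Holevo quantity says that
  -- S(B) − S(E) is concave; the signal term is linear in p.
  have key := D.holevo_postprocess_le hq hM
  rw [holevo, havg, ← hD] at key
  simp only [Fin.sum_univ_two, Matrix.cons_val_zero, Matrix.cons_val_one, ← hD] at key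
  simp only [privateInfo_eq, smul_eq_mul, Pi.add_apply, Pi.smul_apply, add_mul, mul_assoc,
    Finset.sum_add_distrib, ← Finset.mul_sum]
  linarith

end QChannel

/-! ### From one use to n uses: abstract Jensen argument -/

section Superadditivity

variable {R : ℝ → Set ℝ} {n : ℕ} {B : ℝ} {r E : Fin n → ℝ}

theorem exists_le_of_mul_le_sum (hn : 1 ≤ n) (h : n * B ≤ ∑ i, E i) : ∃ i, B ≤ E i := by
  by_contra! hlt
  have : Nonempty (Fin n) := ⟨⟨0, hn⟩⟩
  have := Finset.sum_lt_sum_of_nonempty (Finset.univ_nonempty (α := Fin n)) fun i _ => hlt i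
  simp only [Finset.sum_const, Finset.card_univ, Fintype.card_fin, nsmul_eq_mul] at this
  linarith

/-- Splitting a constraint unevenly among `n` uses does not help if the optimum is concave. -/
theorem sum_le_mul_sSup (hR : Antitone R) (hbdd : ∀ B, BddAbove (R B))
    (hconc : ConcaveOn ℝ {B | (R B).Nonempty} fun B => sSup (R B)) (hn : 1 ≤ n)
    (hr : ∀ i, r i ∈ R (E i)) (hB : n * B ≤ ∑ i, E i) : ∑ i, r i ≤ n * sSup (R B) := by
  have hn0 : (0 : ℝ) < n := by exact_mod_cast hn
  have hw : ∑ _i : Fin n, (n : ℝ)⁻¹ = 1 := by simp [hn0.ne']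
  have hw0 : ∀ i ∈ (Finset.univ : Finset (Fin n)), (0 : ℝ) ≤ (n : ℝ)⁻¹ := fun _ _ =>
    inv_nonneg.mpr hn0.le
  have hmem : ∀ i ∈ (Finset.univ : Finset (Fin n)), E i ∈ {B | (R B).Nonempty} := fun i _ =>
    ⟨r i, hr i⟩
  have h1 := hconc.le_map_sum hw0 hw hmem
  have h2 : (R (∑ i, (n : ℝ)⁻¹ • E i)).Nonempty := hconc.1.sum_mem hw0 hw hmem
  have h3 : B ≤ ∑ i, (n : ℝ)⁻¹ • E i := by
    simp only [smul_eq_mul]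
    rw [← Finset.mul_sum, inv_mul_eq_div, le_div_iff₀ hn0, mul_comm]
    exact hB
  -- The mean energy may exceed B; it is feasible by convexity, and lowering the demand to B only
  -- enlarges the set of rates.
  have h4 := csSup_le_csSup (hbdd B) h2 (hR h3)
  have h5 := h1.trans h4
  simp only [smul_eq_mul] at h5
  rw [← Finset.mul_sum, inv_mul_le_iff₀ hn0] at h5
  exact (Finset.sum_le_sum fun i _ => le_csSup (hbdd _) (hr i)).trans h5

variable {Rn : ℕ → ℝ → Set ℝ}

/-- Some use carries at least the mean energy, and conversely one ensemble can be repeated. Asking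
only for `s ≤ ∑ i, r i` in `hsplit` also covers correlated inputs, for which degradability gives
just an inequality. -/
theorem nonempty_iff_of_additive
    (hsplit : ∀ n B, ∀ s ∈ Rn n B, ∃ r E : Fin n → ℝ, (∀ i, r i ∈ R (E i)) ∧
      n * B ≤ ∑ i, E i ∧ s ≤ ∑ i, r i)
    (hR : Antitone R) (hpow : ∀ n B, ∀ r ∈ R B, n * r ∈ Rn n B) {n : ℕ} (hn : 1 ≤ n) (B : ℝ) :
    (Rn n B).Nonempty ↔ (R B).Nonempty := by
  constructor
  · rintro ⟨s, hs⟩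
    obtain ⟨r, E, hr, hE, -⟩ := hsplit n B s hs
    obtain ⟨i, hi⟩ := exists_le_of_mul_le_sum hn hE
    exact ⟨r i, hR hi (hr i)⟩
  · rintro ⟨r, hr⟩
    exact ⟨_, hpow n B r hr⟩

theorem isLUB_mul_sSup
    (hsplit : ∀ n B, ∀ s ∈ Rn n B, ∃ r E : Fin n → ℝ, (∀ i, r i ∈ R (E i)) ∧
      n * B ≤ ∑ i, E i ∧ s ≤ ∑ i, r i)
    (hR : Antitone R) (hbdd : ∀ B, BddAbove (R B))
    (hconc : ConcaveOn ℝ {B | (R B).Nonempty} fun B => sSup (R B))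
    (hpow : ∀ n B, ∀ r ∈ R B, n * r ∈ Rn n B) {n : ℕ} (hn : 1 ≤ n) {B : ℝ}
    (hB : (R B).Nonempty) : IsLUB (Rn n B) (n * sSup (R B)) := by
  have hn0 : (0 : ℝ) < n := by exact_mod_cast hn
  constructor
  · intro s hs
    obtain ⟨r, E, hr, hE, hsr⟩ := hsplit n B s hs
    exact hsr.trans (sum_le_mul_sSup hR hbdd hconc hn hr hE)
  · intro u hu
    rw [mul_comm, ← le_div_iff₀ hn0]
    refine csSup_le hB fun r hr => ?_
    rw [le_div_iff₀ hn0, mul_comm]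
    exact hu (hpow n B r hr)

end Superadditivity

/-! ### Capacity-power functions -/

section CapacityPower

variable {a b e : Type*} [Fintype a] [Fintype b] [Fintype e]
  [DecidableEq a] [DecidableEq b] [DecidableEq e] {X : Type*} [Fintype X]
  (N : QChannel a b e) (H : Matrix b b ℂ) {ρ : X → Matrix a a ℂ} {𝒮 : Set (Matrix a a ℂ)}

theorem antitone_cqRatesOne : Antitone (cqRatesOne N H ρ) := by
  rintro B B' hB _ ⟨p, hp, hE, rfl⟩
  exact ⟨p, hp, hB.trans hE, rfl⟩

theorem antitone_ratesOne : Antitone (ratesOne N H 𝒮) := by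
  rintro B B' hB _ ⟨m, p, σ, hp, hσ, hE, rfl⟩
  exact ⟨m, p, σ, hp, hσ, hB.trans hE, rfl⟩

theorem bddAbove_cqRatesOne (hρ : ∀ x, IsDensityMatrix (ρ x)) (B : ℝ) :
    BddAbove (cqRatesOne N H ρ B) := by
  refine ⟨Fintype.card b + Fintype.card e, ?_⟩
  rintro _ ⟨p, hp, -, rfl⟩
  exact N.privateInfo_le hp hρ

theorem bddAbove_ratesOne (h𝒮 : ∀ σ ∈ 𝒮, IsDensityMatrix σ) (B : ℝ) :
    BddAbove (ratesOne N H 𝒮 B) := by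
  refine ⟨Fintype.card b + Fintype.card e, ?_⟩
  rintro _ ⟨m, p, σ, hp, hσ, -, rfl⟩
  exact N.privateInfo_le hp fun x => h𝒮 _ (hσ x)

theorem isGreatest_cqPrivateOne (hρ : ∀ x, IsDensityMatrix (ρ x)) {B : ℝ}
    (hB : (cqRatesOne N H ρ B).Nonempty) :
    IsGreatest (cqRatesOne N H ρ B) (cqPrivateOne N H ρ B) := by
  have himage : cqRatesOne N H ρ B
      = (fun p => N.privateInfo p ρ) '' (stdSimplex ℝ X ∩ {p | B ≤ N.outputEnergy H p ρ}) := by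
    ext r
    constructor
    · rintro ⟨p, hp, hE, rfl⟩
      exact ⟨p, ⟨hp, hE⟩, rfl⟩
    · rintro ⟨p, ⟨hp, hE⟩, rfl⟩
      exact ⟨p, hp, hE, rfl⟩
  have hE : Continuous fun p => N.outputEnergy H p ρ := by
    simp only [QChannel.outputEnergy_eq_sum]
    fun_prop
  have hcompact : IsCompact (cqRatesOne N H ρ B) := by
    rw [himage]
    exact ((isCompact_stdSimplex ℝ X).inter_right
      (isClosed_le continuous_const hE)).image_of_continuousOn
        ((N.continuousOn_privateInfo hρ).mono Set.inter_subset_left)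
  exact hcompact.isGreatest_sSup hB

/-- By definition, correlated coding over n uses is one use of the tensor power with alphabet Xⁿ and
energy demand nB. -/
theorem isGreatest_cqPrivateCorrelated (hρ : ∀ x, IsDensityMatrix (ρ x)) {n : ℕ} {B : ℝ}
    (hB : (cqRatesCorrelated N H ρ n B).Nonempty) :
    IsGreatest (cqRatesCorrelated N H ρ n B) (cqPrivateCorrelated N H ρ n B) :=
  isGreatest_cqPrivateOne (N.tensorPow n) (totalHamiltonian n H)
    (ρ := prodState fun _ : Fin n => ρ) (fun x => IsDensityMatrix.tensor fun i => hρ (x i)) hB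

theorem cqRates_split (hρ : ∀ x, IsDensityMatrix (ρ x)) (n : ℕ) (B : ℝ) :
    ∀ s ∈ cqRates N H ρ n B, ∃ r E : Fin n → ℝ, (∀ i, r i ∈ cqRatesOne N H ρ (E i)) ∧
      n * B ≤ ∑ i, E i ∧ s ≤ ∑ i, r i := by
  rintro _ ⟨p, hp, hE, rfl⟩
  rw [N.outputEnergy_tensorPow H _ fun _ => hρ] at hE
  simp only [marginal_prodProb hp] at hE
  exact ⟨_, _, fun i => ⟨p i, hp i, le_rfl, rfl⟩, hE,
    (N.privateInfo_tensorPow_prod hp fun _ => hρ).le⟩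

theorem cqRatesCorrelated_split (hN : N.Degradable) (hρ : ∀ x, IsDensityMatrix (ρ x)) (n : ℕ)
    (B : ℝ) : ∀ s ∈ cqRatesCorrelated N H ρ n B, ∃ r E : Fin n → ℝ,
      (∀ i, r i ∈ cqRatesOne N H ρ (E i)) ∧ n * B ≤ ∑ i, E i ∧ s ≤ ∑ i, r i := by
  rintro _ ⟨p, hp, hE, rfl⟩
  rw [N.outputEnergy_tensorPow H _ fun _ => hρ] at hE
  exact ⟨_, _, fun i => ⟨marginal p i, marginal_mem_stdSimplex hp i, le_rfl, rfl⟩, hE,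
    hN.privateInfo_tensorPow_le hp fun _ => hρ⟩

theorem rates_split (h𝒮 : ∀ σ ∈ 𝒮, IsDensityMatrix σ) (n : ℕ) (B : ℝ) :
    ∀ s ∈ rates N H 𝒮 n B, ∃ r E : Fin n → ℝ, (∀ i, r i ∈ ratesOne N H 𝒮 (E i)) ∧
      n * B ≤ ∑ i, E i ∧ s ≤ ∑ i, r i := by
  rintro _ ⟨m, p, σ, hp, hσ, hE, rfl⟩
  have hσ' : ∀ i k, IsDensityMatrix (σ i k) := fun i k => h𝒮 _ (hσ i k)
  rw [N.outputEnergy_tensorPow H _ hσ'] at hE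
  simp only [marginal_prodProb hp] at hE
  exact ⟨_, _, fun i => ⟨m i, p i, σ i, hp i, hσ i, le_rfl, rfl⟩, hE,
    (N.privateInfo_tensorPow_prod hp hσ').le⟩

theorem mul_mem_cqRates (hρ : ∀ x, IsDensityMatrix (ρ x)) (n : ℕ) (B : ℝ) :
    ∀ r ∈ cqRatesOne N H ρ B, n * r ∈ cqRates N H ρ n B := by
  rintro _ ⟨p, hp, hE, rfl⟩
  refine ⟨fun _ => p, fun _ => hp, ?_, ?_⟩
  · rw [N.outputEnergy_tensorPow H _ fun _ => hρ]
    simp only [marginal_prodProb fun _ : Fin n => hp, Finset.sum_const, Finset.card_univ,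
      Fintype.card_fin, nsmul_eq_mul]
    exact mul_le_mul_of_nonneg_left hE n.cast_nonneg
  · rw [N.privateInfo_tensorPow_prod (fun _ => hp) fun _ => hρ]
    simp

theorem mul_mem_rates (h𝒮 : ∀ σ ∈ 𝒮, IsDensityMatrix σ) (n : ℕ) (B : ℝ) :
    ∀ r ∈ ratesOne N H 𝒮 B, n * r ∈ rates N H 𝒮 n B := by
  rintro _ ⟨m, p, σ, hp, hσ, hE, rfl⟩
  have hσ' : ∀ k, IsDensityMatrix (σ k) := fun k => h𝒮 _ (hσ k)
  refine ⟨fun _ => m, fun _ => p, fun _ => σ, fun _ => hp, fun _ => hσ, ?_, ?_⟩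
  · rw [N.outputEnergy_tensorPow H _ fun _ => hσ']
    simp only [marginal_prodProb fun _ : Fin n => hp, Finset.sum_const, Finset.card_univ,
      Fintype.card_fin, nsmul_eq_mul]
    exact mul_le_mul_of_nonneg_left hE n.cast_nonneg
  · rw [N.privateInfo_tensorPow_prod (fun _ => hp) fun _ => hσ']
    simp

theorem cqRates_subset_cqRatesCorrelated (n : ℕ) (B : ℝ) :
    cqRates N H ρ n B ⊆ cqRatesCorrelated N H ρ n B := by
  rintro _ ⟨p, hp, hE, rfl⟩
  exact ⟨prodProb p, prodProb_mem_stdSimplex hp, hE, rfl⟩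

theorem concaveOn_cqPrivateOne (hN : N.Degradable) (hρ : ∀ x, IsDensityMatrix (ρ x)) :
    ConcaveOn ℝ {B | (cqRatesOne N H ρ B).Nonempty} (cqPrivateOne N H ρ) := by
  have key : ∀ B, (cqRatesOne N H ρ B).Nonempty → ∀ B', (cqRatesOne N H ρ B').Nonempty →
      ∀ s t : ℝ, 0 ≤ s → 0 ≤ t → s + t = 1 → ∃ r ∈ cqRatesOne N H ρ (s • B + t • B'),
        s • cqPrivateOne N H ρ B + t • cqPrivateOne N H ρ B' ≤ r := by
    intro B hB B' hB' s t hs ht hst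
    obtain ⟨p, hp, hE, h⟩ := (isGreatest_cqPrivateOne N H hρ hB).1
    obtain ⟨p', hp', hE', h'⟩ := (isGreatest_cqPrivateOne N H hρ hB').1
    -- Mixing two optimal distributions mixes their energies linearly, while the private information
    -- is at least the mixture of the optima.
    refine ⟨_, ⟨s • p + t • p', convex_stdSimplex ℝ X hp hp' hs ht hst, ?_, rfl⟩, ?_⟩
    · rw [N.outputEnergy_eq_sum] at hE hE' ⊢
      simp only [Pi.add_apply, Pi.smul_apply, smul_eq_mul, add_mul, mul_assoc,
        Finset.sum_add_distrib, ← Finset.mul_sum]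
      gcongr
    · rw [h, h']
      exact (hN.concaveOn_privateInfo hρ).2 hp hp' hs ht hst
  refine ⟨fun B hB B' hB' s t hs ht hst => ?_, fun B hB B' hB' s t hs ht hst => ?_⟩
  · obtain ⟨r, hr, -⟩ := key B hB B' hB' s t hs ht hst
    exact ⟨r, hr⟩
  · obtain ⟨r, hr, hle⟩ := key B hB B' hB' s t hs ht hst
    exact hle.trans (le_csSup (bddAbove_cqRatesOne N H hρ _) hr)

end CapacityPower

end

theorem theorem6 {a b e X : Type*} [Fintype a] [Fintype b] [Fintype e] [Fintype X]
    [DecidableEq a] [DecidableEq b] [DecidableEq e]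
    (N : QChannel a b e) (H : Matrix b b ℂ) (hH : H.IsHermitian)
    -- the fixed signal states of the classical-quantum setting
    (ρ : X → Matrix a a ℂ) (hρ : ∀ x, IsDensityMatrix (ρ x))
    -- the class of allowed signal states of the general setting
    (𝒮 : Set (Matrix a a ℂ)) (h𝒮 : ∀ σ ∈ 𝒮, IsDensityMatrix σ) :
    -- fixed signal states: degradable channel, or concave single-use function
    (N.Degradable ∨
        ConcaveOn ℝ {B | (cqRatesOne N H ρ B).Nonempty} (cqPrivateOne N H ρ) →
      (∀ n : ℕ, 1 ≤ n → ∀ B : ℝ,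
        ((cqRates N H ρ n B).Nonempty ↔ (cqRatesOne N H ρ B).Nonempty)) ∧
      ∀ B : ℝ, (cqRatesOne N H ρ B).Nonempty →
        IsGreatest (cqRatesOne N H ρ B) (cqPrivateOne N H ρ B) ∧
        (∀ n : ℕ, 1 ≤ n →
          IsGreatest (cqRates N H ρ n B) (cqPrivate N H ρ n B) ∧
          cqPrivate N H ρ n B = n * cqPrivateOne N H ρ B) ∧
        ⨆ n : ℕ+, cqPrivate N H ρ n B / n = cqPrivateOne N H ρ B) ∧
    -- fixed signal states, degradable channel: single-letter formula for the regularized quantity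
    -- over all input distributions
    (N.Degradable → ∀ B : ℝ, (cqRatesOne N H ρ B).Nonempty →
        IsLUB (Set.range fun n : ℕ+ => cqPrivateCorrelated N H ρ n B / n)
          (cqPrivateOne N H ρ B) ∧
        ∀ n : ℕ, 1 ≤ n →
          IsGreatest (cqRatesCorrelated N H ρ n B) (cqPrivateCorrelated N H ρ n B)) ∧
    -- probabilities and signal states both vary: concave single-use function
    (ConcaveOn ℝ {B | (ratesOne N H 𝒮 B).Nonempty} (privateOne N H 𝒮) →
      (∀ n : ℕ, 1 ≤ n → ∀ B : ℝ,
        ((rates N H 𝒮 n B).Nonempty ↔ (ratesOne N H 𝒮 B).Nonempty)) ∧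
      ∀ B : ℝ, (ratesOne N H 𝒮 B).Nonempty →
        IsLUB (ratesOne N H 𝒮 B) (privateOne N H 𝒮 B) ∧
        (∀ n : ℕ, 1 ≤ n →
          IsLUB (rates N H 𝒮 n B) (privateN N H 𝒮 n B) ∧
          privateN N H 𝒮 n B = n * privateOne N H 𝒮 B) ∧
        ⨆ n : ℕ+, privateN N H 𝒮 n B / n = privateOne N H 𝒮 B) := by
  have div_eq : ∀ {f : ℕ → ℝ} {c : ℝ}, (∀ n : ℕ, 1 ≤ n → f n = n * c) →
      ∀ n : ℕ+, f n / n = c := by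
    intro f c hf n
    rw [hf n n.pos, mul_div_cancel_left₀ _ (Nat.cast_ne_zero.mpr n.ne_zero)]
  have iSup_eq : ∀ {f : ℕ → ℝ} {c : ℝ}, (∀ n : ℕ, 1 ≤ n → f n = n * c) →
      ⨆ n : ℕ+, f n / n = c := fun hf => by
    simp only [div_eq hf, ciSup_const]
  refine ⟨fun h => ?_, fun hN B hB => ?_, fun hconc => ?_⟩
  -- For uncorrelated inputs, degradability serves only to supply concavity.
  · have hconc := h.elim (fun hN => concaveOn_cqPrivateOne N H hN hρ) id
    refine ⟨fun n hn B => nonempty_iff_of_additive (cqRates_split N H hρ)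
      (antitone_cqRatesOne N H) (mul_mem_cqRates N H hρ) hn B, fun B hB => ?_⟩
    have hmax := isGreatest_cqPrivateOne N H hρ hB
    have hn : ∀ n : ℕ, 1 ≤ n →
        IsGreatest (cqRates N H ρ n B) (n * cqPrivateOne N H ρ B) := fun n hn =>
      ⟨mul_mem_cqRates N H hρ n B _ hmax.1, (isLUB_mul_sSup (cqRates_split N H hρ)
        (antitone_cqRatesOne N H) (bddAbove_cqRatesOne N H hρ) hconc
        (mul_mem_cqRates N H hρ) hn hB).1⟩
    have heq : ∀ n : ℕ, 1 ≤ n → cqPrivate N H ρ n B = n * cqPrivateOne N H ρ B :=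
      fun n h1 => (hn n h1).csSup_eq
    exact ⟨hmax, fun n h1 => ⟨(heq n h1).symm ▸ hn n h1, heq n h1⟩, iSup_eq heq⟩
  · have hconc := concaveOn_cqPrivateOne N H hN hρ
    have hpow : ∀ n B, ∀ r ∈ cqRatesOne N H ρ B, n * r ∈ cqRatesCorrelated N H ρ n B :=
      fun n B r hr => cqRates_subset_cqRatesCorrelated N H n B (mul_mem_cqRates N H hρ n B r hr)
    have hmax := isGreatest_cqPrivateOne N H hρ hB
    have heq : ∀ n : ℕ, 1 ≤ n →
        cqPrivateCorrelated N H ρ n B = n * cqPrivateOne N H ρ B := fun n hn =>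
      (isLUB_mul_sSup (cqRatesCorrelated_split N H hN hρ) (antitone_cqRatesOne N H)
        (bddAbove_cqRatesOne N H hρ) hconc hpow hn hB).csSup_eq ⟨_, hpow n B _ hmax.1⟩
    refine ⟨?_, fun n _ => isGreatest_cqPrivateCorrelated N H hρ ⟨_, hpow n B _ hmax.1⟩⟩
    -- The normalized value is the same for every n, so the regularization is the supremum of a
    -- single point.
    simp only [div_eq heq, Set.range_const]
    exact isLUB_singleton
  · refine ⟨fun n hn B => nonempty_iff_of_additive (rates_split N H h𝒮)
      (antitone_ratesOne N H) (mul_mem_rates N H h𝒮) hn B, fun B hB => ?_⟩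
    have hn : ∀ n : ℕ, 1 ≤ n → IsLUB (rates N H 𝒮 n B) (n * privateOne N H 𝒮 B) :=
      fun n hn => isLUB_mul_sSup (rates_split N H h𝒮) (antitone_ratesOne N H)
        (bddAbove_ratesOne N H h𝒮) hconc (mul_mem_rates N H h𝒮) hn hB
    have heq : ∀ n : ℕ, 1 ≤ n → privateN N H 𝒮 n B = n * privateOne N H 𝒮 B := fun n h1 =>
      (hn n h1).csSup_eq ((nonempty_iff_of_additive (rates_split N H h𝒮)
        (antitone_ratesOne N H) (mul_mem_rates N H h𝒮) h1 B).mpr hB)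
    exact ⟨isLUB_csSup hB (bddAbove_ratesOne N H h𝒮 B),
      fun n h1 => ⟨(heq n h1).symm ▸ hn n h1, heq n h1⟩, iSup_eq heq⟩
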